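/- Let $n,k\ge 1$, let $A_0,\dots,A_{n-1}\in\mathbb{C}^{k\times k}$, let $\|\cdot\|$ be any norm on $\mathbb{C}^k$, and write $\|\cdot\|$ also for the induced matrix norm on $\mathbb{C}^{k\times k}$. Let $$M=\begin{bmatrix}0&I&&\\ &\ddots&\ddots&\\ &&0&I\\ A_0&A_1&\cdots&A_{n-1}\end{bmatrix}\in\mathbb{C}^{nk\times nk}$$ be the block companion matrix, let $E_{j+1}$ $(0\le j\le n-1)$ be the $(j+1)$-st block column of the $nk\times nk$ identity matrix partitioned into $n$ block columns of width $k$, and put $$T_j(z)^{-1}:=E_1^T(zI-M)^{-1}E_{j+1},\qquad z\notin\Lambda(M),$$ where $\Lambda(M)$ is the set of eigenvalues of $M$. (This is only a notation for the right-hand side, which need not be an invertible matrix.) For $\varepsilon>0$ let $\Lambda_\varepsilon(T_j)$ be the set of all $z\in\mathbb{C}$ such that either $z\notin\Lambda(M)$ and $\|T_j(z)^{-1}\|>\varepsilon^{-1}$, or $z$ is a pole of $T_j^{-1}$ (where the norm is regarded as $\infty$). Let $\alpha_\varepsilon(T_j)=\sup\{\operatorname{Re}z: z\in\Lambda_\varepsilon(T_j)\}$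 and let $L_\varepsilon^{(j)}\in[0,\infty]$ be the arc length (one-dimensional Hausdorff measure) of the boundary of $\Lambda_\varepsilon(T_j)$. Suppose that $y:[0,\infty)\to\mathbb{C}^k$ is $n$ times differentiable and satisfies $$y^{(n)}(t)=\sum_{j=0}^{n-1}A_j\,y^{(j)}(t)\quad(t\ge0),\qquad y^{(j)}(0)=y_0^{(j)}\quad(j=0,\dots,n-1),$$ with arbitrary $y_0^{(0)},\dots,y_0^{(n-1)}\in\mathbb{C}^k$. Then for every $\varepsilon>0$: 1. each $\Lambda_\varepsilon(T_j)$ is nonempty and bounded, so that $\alpha_\varepsilon(T_j)$ is a real number; 2. if $\|\cdot\|$ is the Euclidean norm, then $L_\varepsilon^{(j)}<\infty$ for every $j$; 3. for every $t\ge0$, $$\|y(t)\|\le\sum_{j=0}^{n-1}\frac{L_\varepsilon^{(j)}\,e^{\alpha_\varepsilon(T_j)t}}{2\pi\varepsilon}\,\|y_0^{(j)}\|,$$ as an inequality in $[0,\infty]$, with $\infty\cdot0=0$. -/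

import Mathlib

open scoped ENNReal Topology Matrix MeasureTheory

noncomputable section

namespace HigherOrderODE

/-- The block companion matrix of `y⁽ⁿ⁾ = ∑ j, A j y⁽ʲ⁾`. The index `(i, a)` is entry `a` of
block `i`; blocks are numbered `0, …, n - 1`. Block row `i < n - 1` is `I` in block column `i + 1`
and zero elsewhere; the last block row is `A 0, …, A (n - 1)`. -/
def companion {n k : ℕ} (A : Fin n → Matrix (Fin k) (Fin k) ℂ) :
    Matrix (Fin n × Fin k) (Fin n × Fin k) ℂ :=
  Matrix.of fun p q =>
    if (p.1 : ℕ) + 1 < n then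
      (if (q.1 : ℕ) = (p.1 : ℕ) + 1 ∧ q.2 = p.2 then 1 else 0)
    else A q.1 p.2 q.2

/-- Block column `j` (numbered from `0`) of the `nk × nk` identity matrix. -/
def blockCol {n : ℕ} (k : ℕ) (j : Fin n) : Matrix (Fin n × Fin k) (Fin k) ℂ :=
  Matrix.of fun p b => if p.1 = j ∧ p.2 = b then 1 else 0

/-- The generalized resolvent `T_j(z)⁻¹`, that is, the block of `(zI - M)⁻¹` in block row `0` and
block column `j`, where `M` is the companion matrix (meaningful when `zI - M` is invertible). -/
def genResolvent {n k : ℕ} [NeZero n] (A : Fin n → Matrix (Fin k) (Fin k) ℂ) (j : Fin n) (z : ℂ) :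
    Matrix (Fin k) (Fin k) ℂ :=
  (blockCol k (0 : Fin n))ᵀ *
    (z • (1 : Matrix (Fin n × Fin k) (Fin n × Fin k) ℂ) - companion A)⁻¹ * blockCol k j

/-- The matrix norm induced by the vector norm `N`. -/
def inducedNorm {k : ℕ} (N : Seminorm ℂ (Fin k → ℂ)) (B : Matrix (Fin k) (Fin k) ℂ) : ℝ :=
  sInf {c : ℝ | 0 ≤ c ∧ ∀ x : Fin k → ℂ, N (B *ᵥ x) ≤ c * N x}

/-- The `ε`-pseudospectrum `{z : ‖T_j(z)⁻¹‖ > 1 / ε}`. The second set consists of the poles of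
`T_j⁻¹`, at which the norm is `∞` (the eigenvalues of `T_j`). -/
def pseudospectrum {n k : ℕ} [NeZero n] (N : Seminorm ℂ (Fin k → ℂ))
    (A : Fin n → Matrix (Fin k) (Fin k) ℂ) (ε : ℝ) (j : Fin n) : Set ℂ :=
  {z : ℂ | IsUnit (z • (1 : Matrix (Fin n × Fin k) (Fin n × Fin k) ℂ) - companion A) ∧
      ε⁻¹ < inducedNorm N (genResolvent A j z)} ∪
    {z : ℂ | Filter.Tendsto (fun w : ℂ => inducedNorm N (genResolvent A j w)) (𝓝[≠] z)
      Filter.atTop}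

/-- The pseudospectral abscissa `α_ε(T_j)`, the supremum of `Re z` over the pseudospectrum. -/
def pseudoAbscissa {n k : ℕ} [NeZero n] (N : Seminorm ℂ (Fin k → ℂ))
    (A : Fin n → Matrix (Fin k) (Fin k) ℂ) (ε : ℝ) (j : Fin n) : ℝ :=
  sSup (Complex.re '' pseudospectrum N A ε j)

/-- The arc length of the boundary of the pseudospectrum: its one-dimensional Hausdorff measure
(normalized so that a rectifiable simple curve has its length as measure). -/
def boundaryLength {n k : ℕ} [NeZero n] (N : Seminorm ℂ (Fin k → ℂ))
    (A : Fin n → Matrix (Fin k) (Fin k) ℂ) (ε : ℝ) (j : Fin n) : ℝ≥0∞ :=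
  μH[1] (frontier (pseudospectrum N A ε j))

/-- `y` is `n` times differentiable on `[0, ∞)` (one-sidedly at `0`), solves
`y⁽ⁿ⁾ = ∑ j, A j y⁽ʲ⁾` there, and has initial data `y⁽ʲ⁾(0) = y₀ j` for `j < n`. -/
structure IsSolution {n k : ℕ} (A : Fin n → Matrix (Fin k) (Fin k) ℂ)
    (y₀ : Fin n → Fin k → ℂ) (y : ℝ → Fin k → ℂ) : Prop where
  differentiableOn : ∀ j : Fin n,
    DifferentiableOn ℝ (iteratedDerivWithin (j : ℕ) y (Set.Ici 0)) (Set.Ici 0)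
  equation : ∀ t : ℝ, 0 ≤ t → iteratedDerivWithin n y (Set.Ici 0) t =
    ∑ j : Fin n, A j *ᵥ iteratedDerivWithin (j : ℕ) y (Set.Ici 0) t
  initial : ∀ j : Fin n, iteratedDerivWithin (j : ℕ) y (Set.Ici 0) 0 = y₀ j

end HigherOrderODE

end

noncomputable section

namespace HigherOrderODE

open MeasureTheory Set Filter

/-! ### Hausdorff measure and the area swept out by translating a set -/

/-! The jet `(y, y', …)` solves `Y' = MY`, so it is a contour integral of `e^{tz} (zI - M)⁻¹ Y(0)`.
Its first block is a sum over `j` of integrals of `e^{tz} T_j(z)⁻¹ y₀ j / (2πi)`, and the contour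
may be chosen separately for each `j`, since the `j`-th integrand is singular only at poles of
`T_j⁻¹`. On the boundary of the `j`-th pseudospectrum the resolvent has norm at most `1/ε` and
`|e^{tz}| ≤ e^{αt}`, which gives the bound.

That boundary is merely a set of finite `μH[1]` measure, with no parametrization. A contour is
therefore replaced by a cutoff `u`, of compact support and equal to `1` near the singularities, and
the contour integral by the plane integral of `gradForm u • F`. Green's formula on a large square
(`green_square`) shows that the choice of `u` does not matter. Mollifying the indicator of an open
set gives a `u` whose gradient has total mass at most the length of the frontier
(`exists_smooth_indicator`); this rests on an area bound for translates (`volume_translates_le`).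

Eigenvalues of `M` can be removable singularities of `T_j⁻¹`. Writing `T_j⁻¹ = Q / q` in lowest
terms, the estimates are made on the open set `‖q‖ < ε ‖Q‖`, which differs from the pseudospectrum
in finitely many points and has no larger frontier.

The pseudospectrum is bounded because `T_j⁻¹` vanishes at infinity. It is nonempty because a `T_j⁻¹`
without poles would be a polynomial vanishing at infinity, hence zero, which the companion structure
excludes. For the Euclidean norm the frontier lies, up to finitely many points, on the real
algebraic curve `det (|q|² I - ε² Qᴴ Q) = 0`, and such a curve has finite length in any box
(`hausdorffMeasure_zeroLocus_lt_top`). -/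

theorem volume_reProdIm (s t : Set ℝ) : volume (s ×ℂ t) = volume s * volume t := by
  have := Complex.volume_preserving_equiv_real_prod.measure_preimage_equiv (s ×ˢ t)
  rw [Measure.volume_eq_prod, Measure.prod_prod] at this
  rw [← this]
  rfl

/-- The swept set lies in a rectangle of width `h + 2r` whose vertical side is the projection of
`S`, of measure at most the diameter. The supremum over `S.Nonempty` matches the summands in the
formula for `μH[1]`. -/
theorem volume_translates_le_ediam (S : Set ℂ) (h : ℝ) {r : ℝ≥0∞} (hr : r ≠ ∞)
    (hS : Metric.ediam S ≤ r) :
    volume {w : ℂ | ∃ s ∈ Icc (0 : ℝ) h, w + s ∈ S} ≤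
      (ENNReal.ofReal h + 2 * r) * ⨆ _ : S.Nonempty, Metric.ediam S := by
  rcases S.eq_empty_or_nonempty with rfl | hne
  · simp
  simp only [hne, ciSup_pos]
  obtain ⟨p, hp⟩ := hne
  have hsub : {w : ℂ | ∃ s ∈ Icc (0 : ℝ) h, w + s ∈ S} ⊆
      Icc (p.re - r.toReal - h) (p.re + r.toReal) ×ℂ (Complex.im '' S) := by
    rintro w ⟨s, hs, hw⟩
    have hd : dist (w + s) p ≤ r.toReal := by
      have := (Metric.edist_le_ediam_of_mem hw hp).trans hS
      rw [edist_dist] at this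
      exact (ENNReal.ofReal_le_iff_le_toReal hr).1 this
    rw [dist_eq_norm] at hd
    have h1 := (Complex.abs_re_le_norm (w + s - p)).trans hd
    simp only [Complex.sub_re, Complex.add_re, Complex.ofReal_re, abs_le] at h1
    refine ⟨⟨?_, ?_⟩, ⟨_, hw, by simp⟩⟩ <;> linarith [hs.1, hs.2]
  refine (measure_mono hsub).trans ?_
  rw [volume_reProdIm, Real.volume_Icc]
  gcongr
  · rw [show p.re + r.toReal - (p.re - r.toReal - h) = h + 2 * r.toReal by ring]
    refine ENNReal.ofReal_add_le.trans ?_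
    gcongr
    rw [ENNReal.ofReal_mul (by norm_num), ENNReal.ofReal_toReal hr]
    simp
  · refine (Real.volume_le_diam _).trans ?_
    have : LipschitzWith 1 Complex.im :=
      LipschitzWith.of_dist_le_mul fun x y => by
        simpa [dist_eq_norm] using Complex.abs_im_le_norm (x - y)
    simpa using this.ediam_image_le S

/-- Summing the rectangle bound over covers of mesh `r` gives the factor `h + 2r`; letting `r → 0`
leaves exactly `h`, so no constant is lost. -/
theorem volume_translates_le (E : Set ℂ) {h : ℝ} (hh : 0 < h) :
    volume {w : ℂ | ∃ s ∈ Icc (0 : ℝ) h, w + s ∈ E} ≤ ENNReal.ofReal h * μH[1] E := by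
  have key : ∀ r : ℝ≥0∞, 0 < r → r < ∞ → volume {w : ℂ | ∃ s ∈ Icc (0 : ℝ) h, w + s ∈ E} ≤
      (ENNReal.ofReal h + 2 * r) * μH[1] E := by
    intro r hr hr'
    rw [Measure.hausdorffMeasure_apply]
    refine le_trans ?_ (mul_le_mul_right (le_iSup₂ (f := fun (r : ℝ≥0∞) (_ : 0 < r) =>
      ⨅ (t : ℕ → Set ℂ) (_ : E ⊆ ⋃ n, t n) (_ : ∀ n, Metric.ediam (t n) ≤ r),
          ∑' n, ⨆ _ : (t n).Nonempty, Metric.ediam (t n) ^ (1 : ℝ)) r hr) _)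
    have h0 : ENNReal.ofReal h + 2 * r ≠ 0 := by simp [hh.not_ge]
    have h1 : ENNReal.ofReal h + 2 * r ≠ ∞ := ENNReal.add_ne_top.2 ⟨ENNReal.ofReal_ne_top,
          ENNReal.mul_ne_top (by norm_num) hr'.ne⟩
    rw [ENNReal.mul_iInf_of_ne h0 h1]
    refine le_iInf fun t => ?_
    rw [ENNReal.mul_iInf_of_ne h0 h1]
    refine le_iInf fun ht => ?_
    rw [ENNReal.mul_iInf_of_ne h0 h1]
    refine le_iInf fun htr => ?_
    have hcov : {w : ℂ | ∃ s ∈ Icc (0 : ℝ) h, w + s ∈ E} ⊆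
        ⋃ n, {w : ℂ | ∃ s ∈ Icc (0 : ℝ) h, w + s ∈ t n} := by
      rintro w ⟨s, hs, hw⟩
      obtain ⟨n, hn⟩ := mem_iUnion.1 (ht hw)
      exact mem_iUnion.2 ⟨n, s, hs, hn⟩
    refine (measure_mono hcov).trans ((measure_iUnion_le _).trans ?_)
    rw [← ENNReal.tsum_mul_left]
    refine ENNReal.tsum_le_tsum fun n => ?_
    simpa using volume_translates_le_ediam (t n) h hr'.ne (htr n)
  have hlim : Tendsto (fun r : ℝ≥0∞ => (ENNReal.ofReal h + 2 * r) * μH[1] E) (𝓝[>] 0)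
      (𝓝 ((ENNReal.ofReal h + 2 * 0) * μH[1] E)) := by
    refine Tendsto.mono_left ?_ nhdsWithin_le_nhds
    refine ENNReal.Tendsto.mul_const ?_ (Or.inl (by simp [hh.not_ge]))
    exact tendsto_const_nhds.add (ENNReal.Tendsto.const_mul tendsto_id (Or.inr (by norm_num)))
  rw [mul_zero, add_zero] at hlim
  refine ge_of_tendsto hlim ?_
  filter_upwards [self_mem_nhdsWithin, mem_nhdsWithin_of_mem_nhds (Iio_mem_nhds ENNReal.zero_lt_top)]
    with r hr hr' using key r hr hr'

theorem volume_translates_dir_le (E : Set ℂ) {h : ℝ} (hh : 0 < h) {v : ℂ} (hv : ‖v‖ = 1) :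
    volume {w : ℂ | ∃ s ∈ Icc (0 : ℝ) h, w + s * v ∈ E} ≤ ENNReal.ofReal h * μH[1] E := by
  let c : Circle := ⟨v, by simpa [Submonoid.unitSphere] using hv⟩
  have hvol := (rotation c).measurePreserving.measure_preimage_equiv (f := (rotation c).toMeasurableEquiv)
    {w : ℂ | ∃ s ∈ Icc (0 : ℝ) h, w + s * v ∈ E}
  have hE := (rotation c).toIsometryEquiv.hausdorffMeasure_preimage 1 E
  rw [← hvol, ← hE]
  refine le_trans (le_of_eq ?_) (volume_translates_le _ hh)
  congr 1
  ext w
  have hrot (x : ℂ) : (rotation c) x = v * x := rotation_apply c x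
  have (s : ℝ) : (rotation c) w + s * v = rotation c (w + s) := by
    rw [hrot, hrot]; ring
  change (∃ s ∈ Icc (0 : ℝ) h, (rotation c) w + s * v ∈ E) ↔
    (∃ s ∈ Icc (0 : ℝ) h, (rotation c) (w + s) ∈ E)
  simp only [this]

section Mollify

/-! ### Mollified indicator functions -/

theorem exists_mem_frontier_of_segment {U : Set ℂ} {w v : ℂ} {h : ℝ} (hh : 0 ≤ h)
    (hne : (w ∈ U) ≠ (w + h * v ∈ U)) : ∃ s ∈ Icc (0 : ℝ) h, w + s * v ∈ frontier U := by
  have hc : IsPreconnected ((fun s : ℝ => w + s * v) '' Icc 0 h) :=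
    isPreconnected_Icc.image _ (by fun_prop)
  have h0 : w ∈ (fun s : ℝ => w + s * v) '' Icc 0 h := ⟨0, ⟨le_rfl, hh⟩, by simp⟩
  have h1 : w + h * v ∈ (fun s : ℝ => w + s * v) '' Icc 0 h := ⟨h, ⟨hh, le_rfl⟩, rfl⟩
  have key : ∀ {a b : ℂ}, a ∈ (fun s : ℝ => w + s * v) '' Icc 0 h → a ∈ U →
      b ∈ (fun s : ℝ => w + s * v) '' Icc 0 h → b ∉ U →
      (((fun s : ℝ => w + s * v) '' Icc 0 h) ∩ frontier U).Nonempty := by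
    intro a b ha haU hb hbU
    by_contra hemp
    have hsub : (fun s : ℝ => w + s * v) '' Icc 0 h ⊆ interior U ∪ interior Uᶜ := by
      intro x hx
      rw [interior_compl]
      by_contra hx'
      simp only [mem_union, mem_compl_iff, not_or, not_not] at hx'
      exact hemp ⟨x, hx, hx'.2, hx'.1⟩
    obtain ⟨x, -, hx1, hx2⟩ := hc _ _ isOpen_interior isOpen_interior hsub
      ⟨a, ha, (hsub ha).resolve_right fun h => interior_subset h haU⟩
      ⟨b, hb, (hsub hb).resolve_left fun h => hbU (interior_subset h)⟩
    exact interior_subset hx2 (interior_subset hx1)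
  have : (((fun s : ℝ => w + s * v) '' Icc 0 h) ∩ frontier U).Nonempty := by
    by_cases hw : w ∈ U
    · exact key h0 hw h1 fun h => hne (by simp [hw, h])
    · exact key h1 (by by_contra h; exact hne (by simp [hw, h])) h0 hw
  obtain ⟨_, ⟨s, hs, rfl⟩, hf⟩ := this
  exact ⟨s, hs, hf⟩

/-- Weighted form of the area bound, by the layer-cake formula: a segment starting where `t ≤ ψ`
meets `K` at a point where `t ≤ ψ + η`. -/
theorem setLIntegral_translates_le {K : Set ℂ} {ψ : ℂ → ℝ}
    (hψ : Continuous ψ) (hψ0 : ∀ w, 0 ≤ ψ w) {h η : ℝ} (hh : 0 < h) (hη : 0 ≤ η) {v : ℂ}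
    (hv : ‖v‖ = 1) (hosc : ∀ w, ∀ s ∈ Icc (0 : ℝ) h, |ψ (w + s * v) - ψ w| ≤ η) :
    ∫⁻ w in {w | ∃ s ∈ Icc (0 : ℝ) h, w + s * v ∈ K}, ENNReal.ofReal (ψ w) ≤
      ENNReal.ofReal h * ∫⁻ w in K, ENNReal.ofReal (ψ w + η) ∂μH[1] := by
  rw [lintegral_eq_lintegral_meas_le _ (Eventually.of_forall hψ0) hψ.aemeasurable,
    lintegral_eq_lintegral_meas_le _ (Eventually.of_forall fun w => add_nonneg (hψ0 w) hη)
      (by fun_prop), ← lintegral_const_mul' _ _ ENNReal.ofReal_ne_top]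
  refine lintegral_mono fun t => ?_
  have hm : MeasurableSet {a | t ≤ ψ a} := measurableSet_le measurable_const hψ.measurable
  have hm' : MeasurableSet {a | t ≤ ψ a + η} :=
    measurableSet_le measurable_const (hψ.measurable.add_const _)
  rw [Measure.restrict_apply hm, Measure.restrict_apply hm']
  refine le_trans (measure_mono ?_) (volume_translates_dir_le _ hh hv)
  rintro w ⟨hw, s, hs, hsK⟩
  have hw : t ≤ ψ w := hw
  have := abs_le.1 (hosc w s hs)
  exact ⟨s, hs, by change t ≤ _; linarith [this.1], hsK⟩

/-- Convolution of the indicator of `U` with `ρ`. -/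
def mollify (U : Set ℂ) (ρ : ℂ → ℝ) : ℂ → ℝ :=
  convolution (U.indicator fun _ => (1 : ℝ)) ρ (ContinuousLinearMap.lsmul ℝ ℝ) volume

variable {U : Set ℂ} {ρ : ℂ → ℝ}

theorem mollify_apply (z : ℂ) :
    mollify U ρ z = ∫ w, U.indicator (fun _ => (1 : ℝ)) w * ρ (z - w) := rfl

theorem integrable_mollify (hU : MeasurableSet U) (hρ : Continuous ρ) (hc : HasCompactSupport ρ)
    (z : ℂ) : Integrable fun w => U.indicator (fun _ => (1 : ℝ)) w * ρ (z - w) := by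
  have h1 : Integrable fun w => ρ (z - w) :=
    (hρ.integrable_of_hasCompactSupport hc).comp_sub_left z
  refine (h1.indicator hU).congr (Eventually.of_forall fun w => ?_)
  by_cases hw : w ∈ U <;> simp [hw]

theorem mollify_add (z a : ℂ) :
    mollify U ρ (z + a) = ∫ w, U.indicator (fun _ => (1 : ℝ)) (w + a) * ρ (z - w) := by
  rw [mollify_apply, ← integral_add_right_eq_self _ a]
  simp

theorem contDiff_mollify (hU : MeasurableSet U) (hρ : ContDiff ℝ 1 ρ) (hc : HasCompactSupport ρ) :
    ContDiff ℝ 1 (mollify U ρ) :=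
  hc.contDiff_convolution_right (n := 1) _
    ((locallyIntegrable_const (1 : ℝ)).indicator hU) hρ

/-- The difference is the integral of `(1_U(w + hv) - 1_U(w)) ρ(z - w)`, whose integrand vanishes
unless the segment from `w` to `w + hv` meets the frontier. -/
theorem abs_mollify_sub_le (hU : MeasurableSet U) (hρ : Continuous ρ) (hρ0 : ∀ w, 0 ≤ ρ w)
    (hc : HasCompactSupport ρ) (z v : ℂ) {h : ℝ} (hh : 0 ≤ h) :
    ENNReal.ofReal |mollify U ρ (z + h * v) - mollify U ρ z| ≤
      ∫⁻ w in {w | ∃ s ∈ Icc (0 : ℝ) h, w + s * v ∈ frontier U}, ENNReal.ofReal (ρ (z - w)) := by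
  have hi : Integrable fun w => U.indicator (fun _ => (1 : ℝ)) (w + h * v) * ρ (z - w) := by
    have := (integrable_mollify hU hρ hc (z + h * v)).comp_add_right (h * v)
    simpa using this
  rw [mollify_add, mollify_apply, ← integral_sub hi (integrable_mollify hU hρ hc z),
    ← Real.norm_eq_abs, ofReal_norm]
  refine (enorm_integral_le_lintegral_enorm _).trans ?_
  refine le_trans (lintegral_mono fun w => ?_) (lintegral_indicator_le _ _)
  by_cases hw : (w ∈ U) = (w + h * v ∈ U)
  · have : U.indicator (fun _ => (1 : ℝ)) (w + h * v) = U.indicator (fun _ => (1 : ℝ)) w := by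
      by_cases hw' : w ∈ U
      · rw [indicator_of_mem (hw ▸ hw'), indicator_of_mem hw']
      · rw [indicator_of_notMem (hw ▸ hw'), indicator_of_notMem hw']
    simp [this]
  · rw [indicator_of_mem (show w ∈ {w | ∃ s ∈ Icc (0 : ℝ) h, w + s * v ∈ frontier U} from
      exists_mem_frontier_of_segment hh hw), ← sub_mul, enorm_mul,
      ← ofReal_norm (ρ _), Real.norm_of_nonneg (hρ0 _)]
    refine mul_le_of_le_one_left' ?_
    by_cases h1 : w ∈ U <;> by_cases h2 : w + h * v ∈ U <;> simp [h1, h2]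

/-- Divide the increment bound by `h` and let `h → 0`. The oscillation `η` of `ρ` along the segment
costs `η * μH[1] (frontier U)`, which disappears as `η → 0` because the length is finite. -/
theorem abs_fderiv_mollify_le (hU : MeasurableSet U) (hK : μH[1] (frontier U) ≠ ∞)
    (hρ : ContDiff ℝ 1 ρ) (hρ0 : ∀ w, 0 ≤ ρ w)
    (hc : HasCompactSupport ρ) (z : ℂ) {v : ℂ} (hv : ‖v‖ = 1) :
    ENNReal.ofReal |fderiv ℝ (mollify U ρ) z v| ≤
      ∫⁻ w in frontier U, ENNReal.ofReal (ρ (z - w)) ∂μH[1] := by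
  have hslope := (((contDiff_mollify hU hρ hc).differentiable one_ne_zero
    z).hasFDerivAt.hasLineDerivAt v).tendsto_slope_zero_right
  have hunif := hc.uniformContinuous_of_continuous hρ.continuous
  have key : ∀ η : ℝ, 0 < η → ENNReal.ofReal |fderiv ℝ (mollify U ρ) z v| ≤
      ∫⁻ w in frontier U, ENNReal.ofReal (ρ (z - w)) ∂μH[1] +
        ENNReal.ofReal η * μH[1] (frontier U) := by
    intro η hη
    obtain ⟨δ, hδ, hosc⟩ := Metric.uniformContinuous_iff.1 hunif η hη
    refine le_of_tendsto (ENNReal.tendsto_ofReal hslope.abs) ?_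
    filter_upwards [self_mem_nhdsWithin, mem_nhdsWithin_of_mem_nhds (Iio_mem_nhds hδ)]
      with h hh hhδ
    have hh : 0 < h := hh
    have hhδ : h < δ := hhδ
    have h1 := abs_mollify_sub_le hU hρ.continuous hρ0 hc z v hh.le
    have h2 := setLIntegral_translates_le (K := frontier U)
      (ψ := fun w => ρ (z - w)) (hρ.continuous.comp (by fun_prop)) (fun w => hρ0 _) hh hη.le hv
      (fun w s hs => by
        refine (hosc (?_ : dist (z - (w + s * v)) (z - w) < δ)).le
        rw [dist_eq_norm]
        simp only [sub_sub_sub_cancel_left, sub_add_cancel_left, norm_neg, norm_mul, hv,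
          Complex.norm_real, Real.norm_of_nonneg hs.1, mul_one]
        exact hs.2.trans_lt hhδ)
    have h3 := h1.trans h2
    have h4 : ∫⁻ w in frontier U, ENNReal.ofReal (ρ (z - w) + η) ∂μH[1] =
        ∫⁻ w in frontier U, ENNReal.ofReal (ρ (z - w)) ∂μH[1] +
        ENNReal.ofReal η * μH[1] (frontier U) := by
      simp_rw [ENNReal.ofReal_add (hρ0 _) hη.le]
      rw [lintegral_add_right _ measurable_const]
      simp
    rw [h4] at h3
    rw [smul_eq_mul, abs_mul, abs_of_pos (inv_pos.2 hh), ENNReal.ofReal_mul (inv_pos.2 hh).le,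
      ENNReal.ofReal_inv_of_pos hh]
    refine ENNReal.inv_mul_le_iff (by simpa using hh) ENNReal.ofReal_ne_top |>.2 ?_
    simpa using h3
  have hlim : Tendsto (fun η : ℝ => ∫⁻ w in frontier U, ENNReal.ofReal (ρ (z - w)) ∂μH[1] +
        ENNReal.ofReal η * μH[1] (frontier U)) (𝓝[>] 0)
      (𝓝 (∫⁻ w in frontier U, ENNReal.ofReal (ρ (z - w)) ∂μH[1] +
        ENNReal.ofReal 0 * μH[1] (frontier U))) := by
    refine Tendsto.mono_left ?_ nhdsWithin_le_nhds
    exact tendsto_const_nhds.add (ENNReal.Tendsto.mul_const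
      (ENNReal.tendsto_ofReal tendsto_id) (Or.inr hK))
  rw [ENNReal.ofReal_zero, zero_mul, add_zero] at hlim
  exact ge_of_tendsto hlim (eventually_nhdsWithin_of_forall key)

/-- The left side is the length of the gradient of `L`, and `v` is its direction. Thus the
directional bounds control the full gradient with constant `1`. -/
theorem norm_I_mul_sub_le (L : ℂ →L[ℝ] ℝ) :
    ∃ v : ℂ, ‖v‖ = 1 ∧ ‖Complex.I * (L 1 : ℂ) - (L Complex.I : ℂ)‖ ≤ |L v| := by
  set a := L 1
  set b := L Complex.I
  set c : ℂ := a + b * Complex.I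
  have hn : ‖Complex.I * (a : ℂ) - (b : ℂ)‖ = ‖c‖ := by
    rw [show Complex.I * (a : ℂ) - b = Complex.I * c by
      simp only [c]; linear_combination (-(b : ℂ)) * Complex.I_mul_I, norm_mul, Complex.norm_I, one_mul]
  rw [hn]
  by_cases hc : c = 0
  · exact ⟨1, by simp, by simp [hc]⟩
  have hL : ∀ x : ℂ, L x = x.re * a + x.im * b := by
    intro x
    conv_lhs => rw [← Complex.re_add_im x]
    rw [map_add, ← mul_one (x.re : ℂ), ← Complex.real_smul, ← Complex.real_smul, map_smul, map_smul]
    rfl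
  refine ⟨‖c‖⁻¹ • c, by simp [hc], ?_⟩
  have h1 : c.re = a := by simp [c]
  have h2 : c.im = b := by simp [c]
  have h3 : L c = ‖c‖ * ‖c‖ := by
    rw [hL, h1, h2, Complex.norm_mul_self_eq_normSq, Complex.normSq_apply, h1, h2]
  rw [map_smul, h3, smul_eq_mul, inv_mul_cancel_left₀ (norm_ne_zero_iff.2 hc)]
  exact le_abs_self _

/-- Integrate the pointwise bound in `z` and exchange the integrals; each frontier point then
contributes `∫ ρ = 1`. -/
theorem lintegral_gradient_mollify_le (hU : MeasurableSet U) (hK : μH[1] (frontier U) ≠ ∞)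
    (hρ : ContDiff ℝ 1 ρ) (hρ0 : ∀ w, 0 ≤ ρ w)
    (hc : HasCompactSupport ρ) (h1 : ∫ w, ρ w = 1) :
    ∫⁻ z, ENNReal.ofReal ‖Complex.I * (fderiv ℝ (mollify U ρ) z 1 : ℂ) -
      (fderiv ℝ (mollify U ρ) z Complex.I : ℂ)‖ ≤ μH[1] (frontier U) := by
  have : IsFiniteMeasure (μH[1].restrict (frontier U) : Measure ℂ) :=
    ⟨by simpa using hK.lt_top⟩
  calc _ ≤ ∫⁻ z, ∫⁻ w in frontier U, ENNReal.ofReal (ρ (z - w)) ∂μH[1] := by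
        refine lintegral_mono fun z => ?_
        obtain ⟨v, hv, hle⟩ := norm_I_mul_sub_le (fderiv ℝ (mollify U ρ) z)
        exact (ENNReal.ofReal_le_ofReal hle).trans (abs_fderiv_mollify_le hU hK hρ hρ0 hc z hv)
    _ = ∫⁻ w in frontier U, (∫⁻ z, ENNReal.ofReal (ρ (z - w))) ∂μH[1] := by
        refine lintegral_lintegral_swap (ν := μH[1].restrict (frontier U)) ?_
        have := hρ.continuous
        exact (ENNReal.continuous_ofReal.comp
          (by fun_prop : Continuous fun p : ℂ × ℂ => ρ (p.1 - p.2))).aemeasurable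
    _ = μH[1] (frontier U) := by
        have (w : ℂ) : ∫⁻ z, ENNReal.ofReal (ρ (z - w)) = 1 := by
          rw [lintegral_sub_right_eq_self (fun z => ENNReal.ofReal (ρ z)),
            ← ofReal_integral_eq_lintegral_ofReal
              (hρ.continuous.integrable_of_hasCompactSupport hc) (Eventually.of_forall hρ0), h1]
          simp
        simp [this]

theorem mollify_eq_one (h1 : ∫ w, ρ w = 1) {δ : ℝ} (hs : ∀ w, δ ≤ ‖w‖ → ρ w = 0) {z : ℂ}
    (hz : Metric.ball z δ ⊆ U) : mollify U ρ z = 1 := by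
  rw [mollify_apply]
  refine Eq.trans ?_ ((integral_sub_left_eq_self ρ volume z).trans h1)
  refine integral_congr_ae (Eventually.of_forall fun w => ?_)
  by_cases hw : w ∈ U
  · simp [hw]
  · have : ρ (z - w) = 0 := by
      refine hs _ (not_lt.1 fun h => hw (hz ?_))
      rwa [Metric.mem_ball, dist_comm, dist_eq_norm]
    simp [this]

theorem mollify_eq_zero {δ : ℝ} (hs : ∀ w, δ ≤ ‖w‖ → ρ w = 0) {z : ℂ}
    (hz : Disjoint (Metric.ball z δ) U) : mollify U ρ z = 0 := by
  rw [mollify_apply]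
  refine (integral_congr_ae (Eventually.of_forall fun w => ?_)).trans (integral_zero _ _)
  by_cases hw : w ∈ U
  · have : ρ (z - w) = 0 := by
      refine hs _ (not_lt.1 fun h => disjoint_left.1 hz ?_ hw)
      rwa [Metric.mem_ball, dist_comm, dist_eq_norm]
    simp [this]
  · simp [hw]

theorem ball_subset_or_disjoint {z : ℂ} {δ : ℝ} (h : Disjoint (Metric.ball z δ) (frontier U)) :
    Metric.ball z δ ⊆ U ∨ Disjoint (Metric.ball z δ) U := by
  by_contra! hne
  obtain ⟨h1, h2⟩ := hne
  obtain ⟨a, ha, haU⟩ := not_subset.1 h1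
  obtain ⟨b, hb, hbU⟩ := not_disjoint_iff.1 h2
  obtain ⟨s, hs, hf⟩ := exists_mem_frontier_of_segment (U := U) (w := a) (v := b - a) zero_le_one
    (by simp [haU, hbU])
  refine disjoint_left.1 h ?_ hf
  refine (convex_ball z δ) |>.segment_subset ha hb ?_
  rw [segment_eq_image']
  exact ⟨s, hs, by simp⟩

/-- A smooth approximation of the indicator function of a bounded set whose gradient is supported
near the boundary and has integral at most the length of the boundary. -/
theorem exists_smooth_indicator (hU : MeasurableSet U) (hb : Bornology.IsBounded U)
    (hK : μH[1] (frontier U) ≠ ∞) {δ : ℝ} (hδ : 0 < δ) :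
    ∃ u : ℂ → ℝ, ContDiff ℝ 1 u ∧ HasCompactSupport u ∧
      (∀ z, Metric.ball z δ ⊆ U → u =ᶠ[𝓝 z] fun _ => 1) ∧
      (∀ z, Disjoint (Metric.ball z δ) (frontier U) → fderiv ℝ u z = 0) ∧
      ∫⁻ z, ENNReal.ofReal ‖Complex.I * (fderiv ℝ u z 1 : ℂ) - (fderiv ℝ u z Complex.I : ℂ)‖ ≤
        μH[1] (frontier U) := by
  -- The kernel has radius `δ / 2`, so the mollification is constant on a whole ball of radius `δ /
  -- 2` about `z`, as needed for its derivative.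
  let φ : ContDiffBump (0 : ℂ) := ⟨δ / 4, δ / 2, by positivity, by linarith⟩
  set ρ := φ.normed volume
  have hρ : ContDiff ℝ 1 ρ := φ.contDiff_normed
  have hs : ∀ w, δ / 2 ≤ ‖w‖ → ρ w = 0 := by
    intro w hw
    by_contra hne
    have : w ∈ Function.support ρ := hne
    rw [ContDiffBump.support_normed_eq] at this
    simp only [Metric.mem_ball, dist_zero_right] at this
    exact absurd this (not_lt.2 hw)
  have hshrink : ∀ z : ℂ, ∀ᶠ x in 𝓝 z, Metric.ball x (δ / 2) ⊆ Metric.ball z δ := by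
    intro z
    filter_upwards [Metric.ball_mem_nhds z (half_pos hδ)] with x hx
    exact Metric.ball_subset_ball' (by linarith [Metric.mem_ball.1 hx])
  have h1 : ∀ z : ℂ, Metric.ball z δ ⊆ U → mollify U ρ =ᶠ[𝓝 z] fun _ => 1 := by
    intro z hz
    filter_upwards [hshrink z] with x hx
    exact mollify_eq_one φ.integral_normed hs (hx.trans hz)
  refine ⟨mollify U ρ, contDiff_mollify hU hρ φ.hasCompactSupport_normed, ?_, h1, ?_, ?_⟩
  · have : HasCompactSupport (U.indicator fun _ => (1 : ℝ)) :=
      HasCompactSupport.of_support_subset_isCompact hb.isCompact_closure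
        (support_indicator_subset.trans subset_closure)
    exact this.convolution (ContinuousLinearMap.lsmul ℝ ℝ) φ.hasCompactSupport_normed
  · intro z hz
    rcases ball_subset_or_disjoint hz with h | h
    · rw [(h1 z h).fderiv_eq]; simp
    · have : mollify U ρ =ᶠ[𝓝 z] fun _ => 0 := by
        filter_upwards [hshrink z] with x hx
        exact mollify_eq_zero hs (h.mono_left hx)
      rw [this.fderiv_eq]; simp
  · exact lintegral_gradient_mollify_le hU hK hρ φ.nonneg_normed φ.hasCompactSupport_normed
      φ.integral_normed

end Mollify

/-! ### Green's formula and the Cauchy integral over a large square -/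

section Cauchy

variable {E : Type*} [NormedAddCommGroup E] [NormedSpace ℂ E]

/-- The density `i u_x - u_y` of the boundary form against which holomorphic functions are
integrated. -/
def gradForm (u : ℂ → ℝ) (z : ℂ) : ℂ :=
  Complex.I * (fderiv ℝ u z 1 : ℂ) - (fderiv ℝ u z Complex.I : ℂ)

theorem gradForm_eq_zero {u : ℂ → ℝ} {z : ℂ} {c : ℝ} (h : u =ᶠ[𝓝 z] fun _ => c) :
    gradForm u z = 0 := by
  simp [gradForm, h.fderiv_eq]

theorem gradForm_eq_zero_of_notMem {u : ℂ → ℝ} {z : ℂ} (h : z ∉ tsupport u) :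
    gradForm u z = 0 :=
  gradForm_eq_zero (notMem_tsupport_iff_eventuallyEq.1 h)

theorem continuous_gradForm_smul {u : ℂ → ℝ} (hu : ContDiff ℝ 1 u) {F : ℂ → E}
    (hF : ∀ z, DifferentiableAt ℂ F z ∨ u =ᶠ[𝓝 z] fun _ => 1) :
    Continuous fun z => gradForm u z • F z := by
  have hc : Continuous (gradForm u) := by
    have := hu.continuous_fderiv one_ne_zero
    unfold gradForm
    fun_prop
  refine continuous_iff_continuousAt.2 fun z => ?_
  rcases hF z with h | h
  · exact hc.continuousAt.smul h.continuousAt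
  · have : (fun z => gradForm u z • F z) =ᶠ[𝓝 z] fun _ => 0 := by
      filter_upwards [h.eventuallyEq_nhds] with x hx
      rw [gradForm_eq_zero hx, zero_smul]
    exact this.continuousAt

theorem hasCompactSupport_gradForm_smul {u : ℂ → ℝ} (hs : HasCompactSupport u) (F : ℂ → E) :
    HasCompactSupport fun z => gradForm u z • F z :=
  HasCompactSupport.intro hs fun z hz => by rw [gradForm_eq_zero_of_notMem hz, zero_smul]

theorem integral_eq_integral_square {K : ℂ → E} (hK : Integrable K) {R : ℝ}
    (hR : ∀ z, R ≤ ‖z‖ → K z = 0) :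
    ∫ z, K z = ∫ x : ℝ in -R..R, ∫ y : ℝ in -R..R, K (x + y * Complex.I) := by
  have hK' : Integrable (fun p : ℝ × ℝ => K (p.1 + p.2 * Complex.I)) := by
    have := (Complex.volume_preserving_equiv_real_prod.symm
      Complex.measurableEquivRealProd).integrable_comp_emb
      (Complex.measurableEquivRealProd.symm.measurableEmbedding) (g := K) |>.2 hK
    refine this.congr (Eventually.of_forall fun p => ?_)
    simp only [Function.comp, Complex.measurableEquivRealProd_symm_apply, Complex.mk_eq_add_mul_I]
  have h1 : ∫ z, K z = ∫ p : ℝ × ℝ, K (p.1 + p.2 * Complex.I) := by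
    rw [← (Complex.volume_preserving_equiv_real_prod.symm
      Complex.measurableEquivRealProd).integral_comp
      (Complex.measurableEquivRealProd.symm.measurableEmbedding) K]
    simp only [Complex.measurableEquivRealProd_symm_apply, Complex.mk_eq_add_mul_I]
  have hx (x : ℝ) (hx : R ≤ |x|) (y : ℝ) : K (x + y * Complex.I) = 0 := by
    refine hR _ (hx.trans ?_)
    simpa using Complex.abs_re_le_norm (x + y * Complex.I)
  have hy (x y : ℝ) (hy : R ≤ |y|) : K (x + y * Complex.I) = 0 := by
    refine hR _ (hy.trans ?_)
    simpa using Complex.abs_im_le_norm (x + y * Complex.I)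
  have hmem {a : ℝ} (h : ¬ R ≤ |a|) : a ∈ Ioc (-R) R := by
    have := abs_lt.1 (not_le.1 h); exact ⟨this.1, this.2.le⟩
  rw [h1, Measure.volume_eq_prod, integral_prod _ hK',
    intervalIntegral.integral_eq_integral_of_support_subset]
  · refine integral_congr_ae (Eventually.of_forall fun x => ?_)
    refine (intervalIntegral.integral_eq_integral_of_support_subset ?_).symm
    exact fun y h => hmem fun hn => h (hy x y hn)
  · intro x h
    refine hmem fun hn => h ?_
    simp [hx x hn]

/-- Green's formula for `g = (1 - u) F`. The operator `i ∂ₓ - ∂ᵧ` kills holomorphic `F`, so only the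
derivative of `u` survives. On the sides of the square `g = F`, and near the singularities of `F`
one has `g = 0`. -/
theorem green_square [CompleteSpace E] {u : ℂ → ℝ} (hu : ContDiff ℝ 1 u) {F : ℂ → E}
    (hF : ∀ z, DifferentiableAt ℂ F z ∨ u =ᶠ[𝓝 z] fun _ => 1) {R : ℝ} (h0 : 0 < R)
    (hR : tsupport u ⊆ Metric.ball 0 R) :
    ∫ x : ℝ in -R..R, (F (x + (-R : ℝ) * Complex.I) - F (x + R * Complex.I) +
      Complex.I • F (R + x * Complex.I) - Complex.I • F ((-R : ℝ) + x * Complex.I)) =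
      - ∫ z, gradForm u z • F z := by
  set g : ℂ → E := fun z => (1 - u z) • F z
  have hsupp : HasCompactSupport u :=
    (isCompact_closedBall (0 : ℂ) R).of_isClosed_subset (isClosed_tsupport u)
      (hR.trans Metric.ball_subset_closedBall)
  have hg : ∀ z, ∃ g' : ℂ →L[ℝ] E, HasFDerivAt g g' z ∧
      Complex.I • g' 1 - g' Complex.I = -(gradForm u z • F z) := by
    intro z
    rcases hF z with h | h
    · have h1 := (hu.differentiable one_ne_zero z).hasFDerivAt.const_sub 1
      have h2 := h.hasDerivAt.hasFDerivAt.restrictScalars ℝ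
      refine ⟨_, h1.smul h2, ?_⟩
      simp only [gradForm, add_apply, smul_apply, neg_apply,
        ContinuousLinearMap.smulRight_apply, ContinuousLinearMap.coe_restrictScalars',
        ContinuousLinearMap.toSpanSingleton_apply, ← Complex.coe_smul]
      push_cast
      module
    · refine ⟨0, ?_, by simp [gradForm_eq_zero h]⟩
      have : g =ᶠ[𝓝 z] fun _ => 0 := by
        filter_upwards [h] with x hx
        simp [g, hx]
      exact (hasFDerivAt_const (0 : E) z).congr_of_eventuallyEq this
  choose g' hg' hform using hg
  have hcont : Continuous g := continuous_iff_continuousAt.2 fun z => (hg' z).continuousAt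
  have hKc := continuous_gradForm_smul hu hF
  have hKs := hasCompactSupport_gradForm_smul hsupp F
  have hout : ∀ z, R ≤ ‖z‖ → z ∉ tsupport u := fun z hz h => by
    have := hR h
    simp only [Metric.mem_ball, dist_zero_right] at this
    linarith
  have hgF : ∀ z, R ≤ ‖z‖ → g z = F z := fun z hz => by
    simp [g, image_eq_zero_of_notMem_tsupport (hout z hz)]
  have key := Complex.integral_boundary_rect_of_hasFDerivAt_real_off_countable g g' ⟨-R, -R⟩ ⟨R, R⟩ ∅
    countable_empty hcont.continuousOn (fun x _ => hg' x) (by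
      simp only [hform]
      exact (hKc.integrable_of_hasCompactSupport hKs).neg.integrableOn)
  simp only [hform] at key
  rw [integral_eq_integral_square (hKc.integrable_of_hasCompactSupport hKs)
    (fun z hz => by rw [gradForm_eq_zero_of_notMem (hout z hz), zero_smul])]
  simp only [intervalIntegral.integral_neg] at key
  rw [← key, ← intervalIntegral.integral_smul, ← intervalIntegral.integral_smul,
    ← intervalIntegral.integral_sub, ← intervalIntegral.integral_add,
    ← intervalIntegral.integral_sub]
  · refine intervalIntegral.integral_congr fun x hx => ?_
    have hnre (s : ℝ) (hs : |s| = R) (x : ℝ) : R ≤ ‖(s : ℂ) + x * Complex.I‖ := by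
      rw [← hs]; simpa using Complex.abs_re_le_norm (s + x * Complex.I)
    have hnim (s : ℝ) (hs : |s| = R) (x : ℝ) : R ≤ ‖(x : ℂ) + s * Complex.I‖ := by
      rw [← hs]; simpa using Complex.abs_im_le_norm (x + s * Complex.I)
    have e1 : |R| = R := abs_of_pos h0
    have e2 : |-R| = R := by rw [abs_neg, e1]
    simp only [hgF _ (hnre R e1 _), hgF _ (hnre (-R) e2 _), hgF _ (hnim R e1 _),
      hgF _ (hnim (-R) e2 _)]
  all_goals exact Continuous.intervalIntegrable (by fun_prop) _ _

/-- Cauchy's theorem: an entire `F` also admits the cutoff `0`, and the boundary integral over a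
large square is the same for both cutoffs. -/
theorem integral_gradForm_entire [CompleteSpace E] {u : ℂ → ℝ} (hu : ContDiff ℝ 1 u)
    (hs : HasCompactSupport u) {F : ℂ → E} (hF : Differentiable ℂ F) :
    ∫ z, gradForm u z • F z = 0 := by
  obtain ⟨R, hR⟩ := hs.isBounded.subset_ball_lt 0 0
  have h1 := green_square hu (fun z => Or.inl (hF z)) hR.1 hR.2
  have h2 := green_square (u := fun _ => 0) contDiff_const (fun z => Or.inl (hF z)) hR.1
    (by simp [tsupport])
  rw [h1] at h2
  have (z : ℂ) : gradForm (fun _ => 0) z = 0 := gradForm_eq_zero (Eventually.of_forall fun _ => rfl)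
  simpa [this] using h2

/-- Deformation of contours: both sides are minus the boundary integral over one large square. -/
theorem integral_gradForm_congr [CompleteSpace E] {u v : ℂ → ℝ} (hu : ContDiff ℝ 1 u)
    (hs : HasCompactSupport u) (hv : ContDiff ℝ 1 v) (hsv : HasCompactSupport v) {F : ℂ → E}
    (hF : ∀ z, DifferentiableAt ℂ F z ∨ u =ᶠ[𝓝 z] fun _ => 1)
    (hF' : ∀ z, DifferentiableAt ℂ F z ∨ v =ᶠ[𝓝 z] fun _ => 1) :
    ∫ z, gradForm u z • F z = ∫ z, gradForm v z • F z := by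
  obtain ⟨R, hR⟩ := (hs.isBounded.union hsv.isBounded).subset_ball_lt 0 0
  have h1 := green_square hu hF hR.1 (subset_union_left.trans hR.2)
  have h2 := green_square hv hF' hR.1 (subset_union_right.trans hR.2)
  rw [h1] at h2
  exact neg_injective h2

end Cauchy

/-! ### Solutions of linear equations as contour integrals of the resolvent -/

/-- All four sides share the parameter `x`; their contributions add up to `4Ri / (R² + x²)`, which
an arctangent integrates. -/
theorem integral_inv_square {R : ℝ} (hR : 0 < R) :
    ∫ x : ℝ in -R..R, (((x : ℂ) + (-R : ℝ) * Complex.I)⁻¹ - ((x : ℂ) + R * Complex.I)⁻¹ +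
      Complex.I * ((R : ℂ) + x * Complex.I)⁻¹ - Complex.I * (((-R : ℝ) : ℂ) + x * Complex.I)⁻¹) =
      2 * Real.pi * Complex.I := by
  have h (x : ℝ) : ((x : ℂ) + (-R : ℝ) * Complex.I)⁻¹ - ((x : ℂ) + R * Complex.I)⁻¹ +
      Complex.I * ((R : ℂ) + x * Complex.I)⁻¹ - Complex.I * (((-R : ℝ) : ℂ) + x * Complex.I)⁻¹ =
      4 * R * Complex.I * (((R ^ 2 + x ^ 2)⁻¹ : ℝ) : ℂ) := by
    have h1 : (x : ℂ) + (-R : ℝ) * Complex.I ≠ 0 := fun h => by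
      have := congrArg Complex.im h; simp [hR.ne'] at this
    have h2 : (x : ℂ) + R * Complex.I ≠ 0 := fun h => by
      have := congrArg Complex.im h; simp [hR.ne'] at this
    have h3 : (R : ℂ) + x * Complex.I ≠ 0 := fun h => by
      have := congrArg Complex.re h; simp [hR.ne'] at this
    have h4 : ((-R : ℝ) : ℂ) + x * Complex.I ≠ 0 := fun h => by
      have := congrArg Complex.re h; simp [hR.ne'] at this
    have h5 : (R : ℂ) ^ 2 + (x : ℂ) ^ 2 ≠ 0 := by
      have : R ^ 2 + x ^ 2 ≠ 0 := by positivity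
      exact_mod_cast this
    have e1 : ((x : ℂ) + (-R : ℝ) * Complex.I)⁻¹ = (x + R * Complex.I) * (R ^ 2 + x ^ 2 : ℂ)⁻¹ := by
      rw [inv_eq_iff_eq_inv, eq_comm]
      apply inv_eq_of_mul_eq_one_left
      field_simp
      push_cast
      linear_combination (-(R : ℂ) ^ 2) * Complex.I_sq
    have e2 : ((x : ℂ) + R * Complex.I)⁻¹ = (x - R * Complex.I) * (R ^ 2 + x ^ 2 : ℂ)⁻¹ := by
      rw [inv_eq_iff_eq_inv, eq_comm]
      apply inv_eq_of_mul_eq_one_left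
      field_simp
      linear_combination (-(R : ℂ) ^ 2) * Complex.I_sq
    have e3 : ((R : ℂ) + x * Complex.I)⁻¹ = (R - x * Complex.I) * (R ^ 2 + x ^ 2 : ℂ)⁻¹ := by
      rw [inv_eq_iff_eq_inv, eq_comm]
      apply inv_eq_of_mul_eq_one_left
      field_simp
      linear_combination (-(x : ℂ) ^ 2) * Complex.I_sq
    have e4 : (((-R : ℝ) : ℂ) + x * Complex.I)⁻¹ = (-R - x * Complex.I) * (R ^ 2 + x ^ 2 : ℂ)⁻¹ := by
      rw [inv_eq_iff_eq_inv, eq_comm]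
      apply inv_eq_of_mul_eq_one_left
      field_simp
      push_cast
      linear_combination (-(x : ℂ) ^ 2) * Complex.I_sq
    rw [e1, e2, e3, e4]
    push_cast
    ring
  simp_rw [h]
  rw [intervalIntegral.integral_const_mul, intervalIntegral.integral_ofReal,
    integral_inv_sq_add_sq hR.ne', neg_div, div_self hR.ne', Real.arctan_neg, Real.arctan_one]
  have : (R : ℂ) ≠ 0 := by exact_mod_cast hR.ne'
  push_cast
  field_simp
  ring

section Resolvent

variable {E : Type*} [NormedAddCommGroup E] [NormedSpace ℂ E] [CompleteSpace E]
  {T : E →L[ℂ] E} {b : E} {r : ℂ → E} {ρ : ℝ} {u : ℂ → ℝ}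

/-- Here `r` plays the role of `z ↦ (z - T)⁻¹ b`, known only outside a ball. Since `r z - z⁻¹ b =
z⁻¹ T (r z)`, it may be replaced by `z⁻¹ b` on a large square. -/
theorem integral_gradForm_resolvent (hu : ContDiff ℝ 1 u) (hs : HasCompactSupport u)
    (hu1 : ∀ z, ‖z‖ < ρ → u =ᶠ[𝓝 z] fun _ => 1)
    (hd : ∀ z, ρ ≤ ‖z‖ → DifferentiableAt ℂ r z) (hr : ∀ z, ρ ≤ ‖z‖ → z • r z = b + T (r z))
    (hlim : Tendsto r (Bornology.cobounded ℂ) (𝓝 0)) :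
    ∫ z, gradForm u z • r z = -(2 * Real.pi * Complex.I) • b := by
  have hF : ∀ z, DifferentiableAt ℂ r z ∨ u =ᶠ[𝓝 z] fun _ => 1 := fun z =>
    (le_or_gt ρ ‖z‖).imp (hd z) (hu1 z)
  -- Four sides of length `2R`, each with error at most `‖T‖ η / R`, give `8 ‖T‖ η` whatever `R` is.
  have key : ∀ η : ℝ, 0 < η →
      ‖(-∫ z, gradForm u z • r z) - (2 * Real.pi * Complex.I) • b‖ ≤ 8 * (‖T‖ * η) := by
    intro η hη
    have h1 : ∀ᶠ z in Bornology.cobounded ℂ, ‖r z‖ < η := by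
      simpa using hlim.eventually (Metric.ball_mem_nhds _ hη)
    obtain ⟨R₁, -, hR₁⟩ := (Metric.hasBasis_cobounded_compl_closedBall (0 : ℂ)).eventually_iff.1 h1
    obtain ⟨R₂, hR₂⟩ := hs.isBounded.subset_ball_lt 0 0
    set R := max (max (R₁ + 1) R₂) (max ρ 1)
    have hR0 : 0 < R := lt_of_lt_of_le one_pos (by simp [R])
    have hRR₁ : R₁ < R := lt_of_lt_of_le (lt_add_one _) (by simp [R])
    have hρR : ρ ≤ R := by simp [R]
    rw [← green_square hu hF hR0 (hR₂.2.trans (Metric.ball_subset_ball (by simp [R]))),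
      ← integral_inv_square hR0, ← intervalIntegral.integral_smul_const]
    have hnre (s : ℝ) (hs : |s| = R) (x : ℝ) : R ≤ ‖(s : ℂ) + x * Complex.I‖ := by
      rw [← hs]; simpa using Complex.abs_re_le_norm (s + x * Complex.I)
    have hnim (s : ℝ) (hs : |s| = R) (x : ℝ) : R ≤ ‖(x : ℂ) + s * Complex.I‖ := by
      rw [← hs]; simpa using Complex.abs_im_le_norm (x + s * Complex.I)
    have e1 : |R| = R := abs_of_pos hR0
    have e2 : |-R| = R := by rw [abs_neg, e1]
    have hdiff : ∀ z : ℂ, R ≤ ‖z‖ → ‖r z - z⁻¹ • b‖ ≤ ‖T‖ * η / R := by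
      intro z hz
      have hz0 : z ≠ 0 := by rintro rfl; simp at hz; linarith
      have : r z - z⁻¹ • b = z⁻¹ • T (r z) := by
        rw [sub_eq_iff_eq_add, add_comm, ← smul_add, ← hr z (hρR.trans hz), inv_smul_smul₀ hz0]
      rw [this, norm_smul, norm_inv, div_eq_inv_mul]
      have h3 : ‖r z‖ ≤ η := (hR₁ (by simpa using hRR₁.trans_le hz)).le
      gcongr
      exact (T.le_opNorm _).trans (by gcongr)
    have hci : ∀ p : ℝ → ℂ, Continuous p → (∀ x, R ≤ ‖p x‖) → Continuous (fun x => r (p x)) ∧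
        Continuous fun x => (p x)⁻¹ := by
      intro p hp hpR
      constructor
      · exact continuous_iff_continuousAt.2 fun x =>
          ContinuousAt.comp (f := p) (hd _ (hρR.trans (hpR x))).continuousAt hp.continuousAt
      · exact hp.inv₀ fun x h => by have := hpR x; rw [h] at this; simp at this; linarith
    obtain ⟨a1, b1⟩ := hci (fun x => (x : ℂ) + (-R : ℝ) * Complex.I) (by fun_prop) (hnim (-R) e2)
    obtain ⟨a2, b2⟩ := hci (fun x => (x : ℂ) + R * Complex.I) (by fun_prop) (hnim R e1)
    obtain ⟨a3, b3⟩ := hci (fun x => (R : ℂ) + x * Complex.I) (by fun_prop) (hnre R e1)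
    obtain ⟨a4, b4⟩ := hci (fun x => ((-R : ℝ) : ℂ) + x * Complex.I) (by fun_prop) (hnre (-R) e2)
    have hcr : Continuous fun x : ℝ => r (x + (-R : ℝ) * Complex.I) - r (x + R * Complex.I) +
        Complex.I • r (R + x * Complex.I) - Complex.I • r ((-R : ℝ) + x * Complex.I) :=
      ((a1.sub a2).add (a3.const_smul _)).sub (a4.const_smul _)
    rw [← intervalIntegral.integral_sub (hcr.intervalIntegrable _ _)
      (Continuous.intervalIntegrable (by fun_prop) _ _)]
    refine (intervalIntegral.norm_integral_le_of_norm_le_const (C := 4 * (‖T‖ * η / R))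
      fun x _ => ?_).trans (le_of_eq ?_)
    · have d1 := hdiff _ (hnim (-R) e2 x)
      have d2 := hdiff _ (hnim R e1 x)
      have d3 := hdiff _ (hnre R e1 x)
      have d4 := hdiff _ (hnre (-R) e2 x)
      set z1 := (x : ℂ) + (-R : ℝ) * Complex.I
      set z2 := (x : ℂ) + R * Complex.I
      set z3 := (R : ℂ) + x * Complex.I
      set z4 := ((-R : ℝ) : ℂ) + x * Complex.I
      have : r z1 - r z2 + Complex.I • r z3 - Complex.I • r z4 -
          (z1⁻¹ - z2⁻¹ + Complex.I * z3⁻¹ - Complex.I * z4⁻¹) • b =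
          (r z1 - z1⁻¹ • b) - (r z2 - z2⁻¹ • b) + Complex.I • (r z3 - z3⁻¹ • b) -
            Complex.I • (r z4 - z4⁻¹ • b) := by module
      rw [this]
      refine (norm_sub_le _ _).trans ?_
      have := (norm_add_le ((r z1 - z1⁻¹ • b) - (r z2 - z2⁻¹ • b)) (Complex.I • (r z3 - z3⁻¹ • b)))
      have := norm_sub_le (r z1 - z1⁻¹ • b) (r z2 - z2⁻¹ • b)
      simp only [norm_smul, Complex.norm_I, one_mul] at *
      linarith
    · rw [show R - -R = 2 * R by ring, abs_of_pos (by positivity)]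
      field_simp
      ring
  have hz : ‖(-∫ z, gradForm u z • r z) - (2 * Real.pi * Complex.I) • b‖ ≤ 0 := by
    have hl : Tendsto (fun η : ℝ => 8 * (‖T‖ * η)) (𝓝[>] 0) (𝓝 (8 * (‖T‖ * 0))) :=
      (Continuous.tendsto (by fun_prop) 0).mono_left nhdsWithin_le_nhds
    simpa using ge_of_tendsto hl (eventually_nhdsWithin_of_forall key)
  have := sub_eq_zero.1 (norm_le_zero_iff.1 hz)
  rw [neg_smul, ← this, neg_neg]

theorem hasDerivAt_integral_gradForm_resolvent (hu : ContDiff ℝ 1 u) (hs : HasCompactSupport u)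
    (hu1 : ∀ z, ‖z‖ < ρ → u =ᶠ[𝓝 z] fun _ => 1)
    (hd : ∀ z, ρ ≤ ‖z‖ → DifferentiableAt ℂ r z) (hr : ∀ z, ρ ≤ ‖z‖ → z • r z = b + T (r z))
    (t : ℝ) :
    HasDerivAt (fun t : ℝ => ∫ z, gradForm u z • Complex.exp (t * z) • r z)
      (T (∫ z, gradForm u z • Complex.exp (t * z) • r z)) t := by
  have hF : ∀ z, DifferentiableAt ℂ r z ∨ u =ᶠ[𝓝 z] fun _ => 1 := fun z =>
    (le_or_gt ρ ‖z‖).imp (hd z) (hu1 z)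
  have hK := continuous_gradForm_smul hu hF
  have hKs := hasCompactSupport_gradForm_smul hs r
  have hc (g : ℂ → ℂ) (hg : Continuous g) :
      Integrable fun z => g z • gradForm u z • r z :=
    (hg.smul hK).integrable_of_hasCompactSupport hKs.smul_left
  have hcomm (t : ℝ) (z : ℂ) : gradForm u z • Complex.exp (t * z) • r z =
      Complex.exp (t * z) • gradForm u z • r z := smul_comm _ _ _
  simp_rw [hcomm]
  have hder := hasDerivAt_integral_of_dominated_loc_of_deriv_le (μ := volume)
    (F := fun (t : ℝ) z => Complex.exp (t * z) • gradForm u z • r z)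
    (F' := fun (t : ℝ) z => (z * Complex.exp (t * z)) • gradForm u z • r z)
    (x₀ := t) (s := Metric.ball t 1)
    (bound := fun z => (‖z‖ * Real.exp ((|t| + 1) * ‖z‖)) * ‖gradForm u z • r z‖)
    (Metric.ball_mem_nhds t one_pos)
    (Eventually.of_forall fun s => (hc _ (by fun_prop)).aestronglyMeasurable)
    (hc _ (by fun_prop)) (hc _ (by fun_prop)).aestronglyMeasurable
    (Eventually.of_forall fun z s hs => by
      rw [norm_smul, norm_mul, Complex.norm_exp]
      gcongr
      have h1 : |s| ≤ |t| + 1 := by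
        have := abs_sub_abs_le_abs_sub s t
        have h2 : |s - t| < 1 := hs
        linarith
      calc ((s : ℂ) * z).re = s * z.re := by simp
        _ ≤ |s * z.re| := le_abs_self _
        _ = |s| * |z.re| := abs_mul _ _
        _ ≤ (|t| + 1) * ‖z‖ := by gcongr; exact Complex.abs_re_le_norm z)
    (by
      refine Continuous.integrable_of_hasCompactSupport (by fun_prop) ?_
      exact hKs.norm.mul_left)
    (Eventually.of_forall fun z s _ => by
      have h1 : HasDerivAt (fun s : ℝ => (s : ℂ) * z) z s := by
        simpa using (Complex.ofRealCLM.hasDerivAt (x := s)).mul_const z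
      simpa [mul_comm] using h1.cexp.smul_const (gradForm u z • r z))
  refine hder.2.congr_deriv ?_
  rw [← T.integral_comp_comm (hc _ (by fun_prop)), ← sub_eq_zero, ← integral_sub
    (hc _ (by fun_prop)) (T.integrable_comp (hc _ (by fun_prop)))]
  -- Differentiating produces `z r(z) = b + T (r z)`; the extra term `e^{tz} b` is entire and
  -- integrates to zero.
  have hent := integral_gradForm_entire (F := fun z => Complex.exp (t * z) • b) hu hs (by fun_prop)
  rw [← hent]
  refine integral_congr_ae (Eventually.of_forall fun z => ?_)
  rcases le_or_gt ρ ‖z‖ with h | h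
  · have h1 : T (r z) = z • r z - b := by rw [hr z h]; abel
    simp only [map_smul, h1]
    module
  · simp [gradForm_eq_zero (hu1 z h)]

/-- A solution of `Y' = T Y` on `[0, ∞)` is a contour integral of the resolvent. -/
theorem solution_eq_integral_resolvent (hu : ContDiff ℝ 1 u) (hs : HasCompactSupport u)
    (hu1 : ∀ z, ‖z‖ < ρ → u =ᶠ[𝓝 z] fun _ => 1)
    (hd : ∀ z, ρ ≤ ‖z‖ → DifferentiableAt ℂ r z) (hr : ∀ z, ρ ≤ ‖z‖ → z • r z = b + T (r z))
    (hlim : Tendsto r (Bornology.cobounded ℂ) (𝓝 0)) {Y : ℝ → E} (hY0 : Y 0 = b)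
    (hY : ∀ t, 0 ≤ t → HasDerivWithinAt Y (T (Y t)) (Ici 0) t) {t : ℝ} (ht : 0 ≤ t) :
    -(2 * Real.pi * Complex.I) • Y t = ∫ z, gradForm u z • Complex.exp (t * z) • r z := by
  -- Both sides solve `X' = T X` with the same value at `0`, and `T` is Lipschitz.
  have h := ODE_solution_unique (v := fun _ => T) (K := ‖T‖₊) (a := 0) (b := t)
    (f := fun t => -(2 * Real.pi * Complex.I) • Y t)
    (g := fun t : ℝ => ∫ z, gradForm u z • Complex.exp (t * z) • r z)
    (fun _ => T.lipschitz)
    (fun s hs => (((hY s hs.1).continuousWithinAt).mono Icc_subset_Ici_self).const_smul _)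
    (fun s hs => by
      rw [map_smul]
      exact ((hY s hs.1).mono (Ici_subset_Ici.2 hs.1)).const_smul _)
    (fun s _ => (hasDerivAt_integral_gradForm_resolvent hu hs hu1 hd hr
      s).continuousAt.continuousWithinAt)
    (fun s _ => (hasDerivAt_integral_gradForm_resolvent hu hs hu1 hd hr s).hasDerivWithinAt)
    (by
      have := integral_gradForm_resolvent hu hs hu1 hd hr hlim
      simp [hY0, this])
  exact h ⟨ht, le_rfl⟩

end Resolvent

/-! ### Length of plane real algebraic curves -/

/-- On `S` the map `π` has an `L`-Lipschitz inverse, and `S` is the image of that inverse. -/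
theorem hausdorffMeasure_le_of_dist_le {S : Set ℂ} {π : ℂ → ℝ} {L : NNReal}
    (h : ∀ a ∈ S, ∀ b ∈ S, dist a b ≤ L * |π a - π b|) :
    μH[1] S ≤ L * volume (π '' S) := by
  have hl : LipschitzOnWith L (Function.invFunOn π S) (π '' S) := by
    refine LipschitzOnWith.of_dist_le_mul fun x hx y hy => ?_
    have := h _ (Function.invFunOn_mem hx) _ (Function.invFunOn_mem hy)
    rwa [Function.invFunOn_eq hx, Function.invFunOn_eq hy] at this
  have hi : S ⊆ Function.invFunOn π S '' (π '' S) := by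
    intro a ha
    have hx : π a ∈ π '' S := ⟨a, ha, rfl⟩
    refine ⟨π a, hx, ?_⟩
    have := h _ (Function.invFunOn_mem hx) a ha
    rw [Function.invFunOn_eq hx, sub_self, abs_zero, mul_zero] at this
    exact dist_le_zero.1 this
  have := hl.hausdorffMeasure_image_le (d := 1) zero_le_one
  rw [hausdorffMeasure_real, ENNReal.rpow_one] at this
  exact (measure_mono hi).trans this

/-- Cut `S` into countably many disjoint pieces with Lipschitz inverse projections. The sum of the
measures of their projections is the integral of the number of pieces met by a fibre, at most `d` on
`[-R, R]`. -/
theorem hausdorffMeasure_le_of_fibers {S : Set ℂ} (hS : MeasurableSet S) {π : ℂ → ℝ}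
    (hπ : Continuous π) {L : NNReal} {R : ℝ} (hR : ∀ z ∈ S, π z ∈ Icc (-R) R) {d : ℕ}
    (hfib : ∀ x, ∃ F : Finset ℂ, F.card ≤ d ∧ ∀ z ∈ S, π z = x → z ∈ F)
    (hloc : ∀ z ∈ S, ∃ V ∈ 𝓝 z, ∀ a ∈ S ∩ V, ∀ b ∈ S ∩ V, dist a b ≤ L * |π a - π b|) :
    μH[1] S < ∞ := by
  choose! V hV hVL using hloc
  rcases S.eq_empty_or_nonempty with rfl | hne
  · simp
  obtain ⟨t, htS, htc, hcov⟩ := TopologicalSpace.countable_cover_nhdsWithin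
    (f := fun z => interior (V z)) (s := S)
    fun z hz => mem_nhdsWithin_of_mem_nhds (interior_mem_nhds.2 (hV z hz))
  have htne : t.Nonempty := by
    rcases t.eq_empty_or_nonempty with rfl | h
    · obtain ⟨z, hz⟩ := hne
      simpa using hcov hz
    · exact h
  obtain ⟨e, rfl⟩ := htc.exists_eq_range htne
  let W : ℕ → Set ℂ := fun n => interior (V (e n))
  let P : ℕ → Set ℂ := fun n => S ∩ disjointed W n
  have hW : ∀ n, MeasurableSet (W n) := fun n => isOpen_interior.measurableSet
  have hP : ∀ n, MeasurableSet (P n) := fun n => hS.inter (MeasurableSet.disjointed hW n)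
  have hSP : S ⊆ ⋃ n, P n := by
    intro z hz
    have h1 : z ∈ ⋃ n, W n := by
      have := hcov hz
      simpa [W] using this
    rw [← iUnion_disjointed] at h1
    obtain ⟨n, hn⟩ := mem_iUnion.1 h1
    exact mem_iUnion.2 ⟨n, hz, hn⟩
  have hPL : ∀ n, ∀ a ∈ P n, ∀ b ∈ P n, dist a b ≤ L * |π a - π b| := fun n a ha b hb =>
    hVL (e n) (htS ⟨n, rfl⟩) a ⟨ha.1, interior_subset (disjointed_subset W n ha.2)⟩ b
      ⟨hb.1, interior_subset (disjointed_subset W n hb.2)⟩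
  -- An injective continuous image of a Borel set is Borel.
  have himg : ∀ n, MeasurableSet (π '' P n) := fun n =>
    (hP n).image_of_continuousOn_injOn hπ.continuousOn fun a ha b hb hab => by
      have := hPL n a ha b hb
      rw [hab, sub_self, abs_zero, mul_zero] at this
      exact dist_le_zero.1 this
  have hcount : ∀ x, ∑' n, (π '' P n).indicator (fun _ => (1 : ℝ≥0∞)) x ≤
      (Icc (-R) R).indicator (fun _ => (d : ℝ≥0∞)) x := by
    intro x
    by_cases hx : x ∈ Icc (-R) R
    · rw [indicator_of_mem hx, ENNReal.tsum_eq_iSup_sum]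
      refine iSup_le fun s => ?_
      classical
      obtain ⟨F, hFd, hF⟩ := hfib x
      rw [Finset.sum_indicator_eq_sum_filter _ _ (fun n => π '' P n) (fun _ => x)]
      simp only [Finset.sum_const, nsmul_eq_mul, mul_one, Nat.cast_le]
      refine le_trans ?_ hFd
      have hmem : ∀ n ∈ s.filter (fun n => x ∈ π '' P n), ∃ z ∈ P n, π z = x := fun n hn =>
        (Finset.mem_filter.1 hn).2
      choose! g hg hgx using hmem
      refine Finset.card_le_card_of_injOn g (fun n hn => hF _ (hg n hn).1 (hgx n hn)) ?_
      intro n hn m hm hnm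
      by_contra hne
      exact disjoint_left.1 (disjoint_disjointed W hne) (hg n hn).2 (hnm ▸ (hg m hm).2)
    · rw [indicator_of_notMem hx]
      simp only [nonpos_iff_eq_zero, ENNReal.tsum_eq_zero]
      refine fun n => indicator_of_notMem ?_ _
      rintro ⟨z, hz, rfl⟩
      exact hx (hR z hz.1)
  calc μH[1] S ≤ ∑' n, μH[1] (P n) := (measure_mono hSP).trans (measure_iUnion_le _)
    _ ≤ ∑' n, L * volume (π '' P n) :=
        ENNReal.tsum_le_tsum fun n => hausdorffMeasure_le_of_dist_le (hPL n)
    _ = L * ∫⁻ x, ∑' n, (π '' P n).indicator (fun _ => (1 : ℝ≥0∞)) x := by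
        rw [ENNReal.tsum_mul_left, lintegral_tsum fun n =>
          (measurable_const.indicator (himg n)).aemeasurable]
        simp [himg]
    _ ≤ L * ∫⁻ x, (Icc (-R) R).indicator (fun _ => (d : ℝ≥0∞)) x := by
        gcongr; exact hcount _
    _ < ∞ := by
        rw [lintegral_indicator measurableSet_Icc]
        simp only [lintegral_const, MeasurableSet.univ, Measure.restrict_apply, univ_inter,
          Real.volume_Icc]
        exact ENNReal.mul_lt_top ENNReal.coe_lt_top
          (ENNReal.mul_lt_top (ENNReal.natCast_lt_top d) ENNReal.ofReal_lt_top)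

/-- The value of a real polynomial in two variables at `(re z, im z)`. -/
def planeEval (z : ℂ) : MvPolynomial (Fin 2) ℝ →+* ℝ := MvPolynomial.eval ![z.re, z.im]

theorem hasStrictFDerivAt_planeEval (p : MvPolynomial (Fin 2) ℝ) (z : ℂ) :
    HasStrictFDerivAt (fun z => planeEval z p)
      (planeEval z (MvPolynomial.pderiv 0 p) • Complex.reCLM +
        planeEval z (MvPolynomial.pderiv 1 p) • Complex.imCLM) z := by
  induction p using MvPolynomial.induction_on with
  | C a => simpa [planeEval] using hasStrictFDerivAt_const a z
  | add p q hp hq =>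
    simp only [map_add]
    refine (hp.add hq).congr_fderiv ?_
    module
  | mul_X p i hp =>
    have hX : HasStrictFDerivAt (fun z => planeEval z (MvPolynomial.X i))
        (planeEval z (MvPolynomial.pderiv 0 (MvPolynomial.X i)) • Complex.reCLM +
        planeEval z (MvPolynomial.pderiv 1 (MvPolynomial.X i)) • Complex.imCLM) z := by
      fin_cases i
      · simpa [planeEval, MvPolynomial.pderiv_X, Pi.single_apply] using!
          Complex.reCLM.hasStrictFDerivAt (x := z)
      · simpa [planeEval, MvPolynomial.pderiv_X, Pi.single_apply] using!
          Complex.imCLM.hasStrictFDerivAt (x := z)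
    simp only [map_mul, Derivation.leibniz, map_add, smul_eq_mul]
    refine (hp.mul hX).congr_fderiv ?_
    module

theorem totalDegree_pderiv_le (p : MvPolynomial (Fin 2) ℝ) (i : Fin 2) :
    (MvPolynomial.pderiv i p).totalDegree ≤ p.totalDegree - 1 := by
  conv_lhs => rw [p.as_sum]
  rw [map_sum]
  refine MvPolynomial.totalDegree_finsetSum_le fun s hs => ?_
  rw [MvPolynomial.pderiv_monomial]
  by_cases h0 : s i = 0
  · simp [h0]
  refine (MvPolynomial.totalDegree_monomial_le _ _).trans ?_
  have h1 : s.degree ≤ p.totalDegree := MvPolynomial.le_totalDegree hs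
  have h2 : (s - Finsupp.single i 1) + Finsupp.single i 1 = s :=
    tsub_add_cancel_of_le (Finsupp.single_le_iff.2 (Nat.one_le_iff_ne_zero.2 h0))
  have h3 := congrArg Finsupp.degree h2
  rw [map_add, Finsupp.degree_single] at h3
  change (s - Finsupp.single i 1).degree ≤ _
  omega

/-- The hypotheses give `|Y| ≤ |X| + (|X| + |Y|) / 3`, that is `(2/3) |Y| ≤ (4/3) |X|`. -/
theorem abs_le_two_mul_of_abs_le {A B X Y : ℝ} (hAB : |A| ≤ |B|) (hB : B ≠ 0)
    (h : |A * X + B * Y| ≤ |B| / 3 * (|X| + |Y|)) : |Y| ≤ 2 * |X| := by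
  have h1 : |B * Y| ≤ |A * X + B * Y| + |A * X| := by
    have := abs_sub (A * X + B * Y) (A * X)
    simpa using this
  rw [abs_mul, abs_mul A] at h1
  have h2 : |A| * |X| ≤ |B| * |X| := by gcongr
  have hB' : 0 < |B| := abs_pos.2 hB
  by_contra hlt
  push Not at hlt
  nlinarith

/-- By strict differentiability, at two zeros near `z` the increment of `p` vanishes and only the
linear part remains, up to a small error. This does the work of the implicit function theorem. -/
theorem exists_nhds_planeEval_lipschitz {p : MvPolynomial (Fin 2) ℝ} {z : ℂ} {c : ℝ} (hc : 0 < c) :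
    ∃ V ∈ 𝓝 z, ∀ a ∈ V, planeEval a p = 0 → ∀ b ∈ V, planeEval b p = 0 →
      |planeEval z (MvPolynomial.pderiv 0 p) * (a.re - b.re) +
        planeEval z (MvPolynomial.pderiv 1 p) * (a.im - b.im)| ≤
        c * (|a.re - b.re| + |a.im - b.im|) := by
  have h := (hasStrictFDerivAt_planeEval p z).isLittleO.def hc
  rw [nhds_prod_eq] at h
  obtain ⟨V, hV, hh⟩ := mem_prod_same_iff.1 h
  refine ⟨V, hV, fun a ha ha0 b hb hb0 => ?_⟩
  have h1 := hh (mk_mem_prod ha hb)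
  simp only [mem_ofPred_eq, ha0, hb0, sub_zero, zero_sub, norm_neg] at h1
  refine le_trans (le_of_eq ?_) (h1.trans ?_)
  · simp
  · gcongr
    simpa using Complex.norm_le_abs_re_add_abs_im (a - b)

/-- The index `i` is the variable running along the line; the other coordinate is fixed at `x`. The
restriction of `p` to the line has degree at most `p.totalDegree`, and it is not the zero
polynomial, since otherwise the `i`-th partial derivative would vanish at `z`. -/
theorem fiber_card_le (p : MvPolynomial (Fin 2) ℝ) (i : Fin 2) (x : ℝ) :
    ∃ F : Finset ℂ, F.card ≤ p.totalDegree ∧ ∀ z : ℂ, planeEval z p = 0 →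
      planeEval z (MvPolynomial.pderiv i p) ≠ 0 → (![z.im, z.re] i = x) → z ∈ F := by
  classical
  let f : Fin 2 → Polynomial ℝ := ![![Polynomial.X, Polynomial.C x] i, ![Polynomial.C x, Polynomial.X] i]
  let g : ℝ → ℂ := fun s => ![(⟨s, x⟩ : ℂ), ⟨x, s⟩] i
  set P : Polynomial ℝ := MvPolynomial.aeval f p
  have hP : ∀ s, P.eval s = planeEval (g s) p := by
    intro s
    have : (Polynomial.evalRingHom s).comp (MvPolynomial.aeval f).toRingHom = planeEval (g s) := by
      refine MvPolynomial.ringHom_ext (fun r => ?_) fun j => ?_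
      · simp [planeEval]
      · fin_cases i <;> fin_cases j <;> simp [planeEval, f, g]
    exact congrArg (fun φ => φ p) this
  have hdeg : P.natDegree ≤ p.totalDegree := by
    have := MvPolynomial.aeval_natDegree_le p le_rfl f (n := 1) (fun j => by
      fin_cases i <;> fin_cases j <;> simp [f])
    simpa using this
  refine ⟨P.roots.toFinset.image g, ?_, fun z hz hd hx => ?_⟩
  · exact Finset.card_image_le.trans ((Multiset.toFinset_card_le _).trans
      ((Polynomial.card_roots' P).trans hdeg))
  · have hgz : g (![z.re, z.im] i) = z := by
      fin_cases i
      · simp only [Fin.zero_eta, Matrix.cons_val_zero] at hx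
        simp [g, ← hx]
      · simp only [Fin.mk_one, Matrix.cons_val_one, Matrix.cons_val_fin_one] at hx
        simp [g, ← hx]
    refine Finset.mem_image.2 ⟨![z.re, z.im] i, ?_, hgz⟩
    rw [Multiset.mem_toFinset, Polynomial.mem_roots']
    refine ⟨fun h0 => hd ?_, by rw [Polynomial.IsRoot, hP, hgz, hz]⟩
    have hzero : ∀ s, planeEval (g s) p = 0 := fun s => by rw [← hP, h0, Polynomial.eval_zero]
    have hg : HasDerivAt g (![(1 : ℂ), Complex.I] i) (![z.re, z.im] i) := by
      fin_cases i
      · have : g = fun s : ℝ => (s : ℂ) + x * Complex.I := by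
          ext s; simp [g, Complex.mk_eq_add_mul_I]
        rw [this]
        exact (Complex.ofRealCLM.hasDerivAt).add_const _
      · have : g = fun s : ℝ => (x : ℂ) + s * Complex.I := by
          ext s; simp [g, Complex.mk_eq_add_mul_I]
        rw [this]
        simpa using ((Complex.ofRealCLM.hasDerivAt (x := z.im)).mul_const Complex.I).const_add (x : ℂ)
    have h1 := (hasStrictFDerivAt_planeEval p (g (![z.re, z.im] i))).hasFDerivAt.comp_hasDerivAt _ hg
    have h2 : HasDerivAt ((fun z => planeEval z p) ∘ g) 0 (![z.re, z.im] i) :=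
      (hasDerivAt_const _ (0 : ℝ)).congr_of_eventuallyEq (Eventually.of_forall hzero)
    have h3 := h1.unique h2
    rw [hgz] at h3
    fin_cases i <;> simpa using h3

theorem continuous_planeEval (p : MvPolynomial (Fin 2) ℝ) : Continuous fun z => planeEval z p :=
  continuous_iff_continuousAt.2 fun z => (hasStrictFDerivAt_planeEval p z).hasFDerivAt.continuousAt

/-- Induction on the degree. Critical zeros lie on the zero locus of a nonzero partial derivative,
of smaller degree. Near any other zero the curve is a Lipschitz graph over the axis selected by the
larger partial derivative, with finite fibres. -/
theorem hausdorffMeasure_zeroLocus_lt_top (R : ℝ) (n : ℕ) : ∀ p : MvPolynomial (Fin 2) ℝ, p ≠ 0 →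
    p.totalDegree ≤ n → μH[1] ({z : ℂ | planeEval z p = 0} ∩ (Icc (-R) R ×ℂ Icc (-R) R)) < ∞ := by
  induction n with
  | zero =>
    intro p hp hd
    have hC := MvPolynomial.totalDegree_eq_zero_iff_eq_C.1 (Nat.le_zero.1 hd)
    have : {z : ℂ | planeEval z p = 0} = ∅ := by
      refine eq_empty_of_forall_notMem fun z hz => hp ?_
      have hz : planeEval z p = 0 := hz
      rw [hC, planeEval, MvPolynomial.eval_C] at hz
      rw [hC, hz, map_zero]
    simp [this]
  | succ n ih =>
    intro p hp hd
    set B : Set ℂ := Icc (-R) R ×ℂ Icc (-R) R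
    have hB : MeasurableSet B :=
      (Complex.measurable_re measurableSet_Icc).inter (Complex.measurable_im measurableSet_Icc)
    set p0 := MvPolynomial.pderiv 0 p
    set p1 := MvPolynomial.pderiv 1 p
    have hm (q : MvPolynomial (Fin 2) ℝ) : Measurable fun z => planeEval z q :=
      (continuous_planeEval q).measurable
    have hdeg (i : Fin 2) : (MvPolynomial.pderiv i p).totalDegree ≤ n :=
      (totalDegree_pderiv_le p i).trans (by omega)
    have hcrit : μH[1] ({z : ℂ | planeEval z p = 0 ∧ planeEval z p0 = 0 ∧ planeEval z p1 = 0} ∩ B)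
        < ∞ := by
      by_cases h0 : p0 = 0
      · by_cases h1 : p1 = 0
        -- In characteristic zero both partial derivatives vanish only for constants:
        -- differentiation multiplies each coefficient by a positive exponent.
        · have hC : p.totalDegree = 0 := by
            rw [MvPolynomial.totalDegree_eq_zero_iff]
            intro m hm j
            by_contra hj
            have hc := MvPolynomial.coeff_pderiv (i := j) p (m - Finsupp.single j 1)
            rw [tsub_add_cancel_of_le (Finsupp.single_le_iff.2 (Nat.one_le_iff_ne_zero.2 hj))] at hc
            have : MvPolynomial.pderiv j p = 0 := by fin_cases j <;> assumption
            rw [this, MvPolynomial.coeff_zero, eq_comm, mul_eq_zero] at hc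
            rcases hc with hc | hc
            · exact MvPolynomial.mem_support_iff.1 hm hc
            · have : (0 : ℝ) ≤ ((m - Finsupp.single j 1 : Fin 2 →₀ ℕ) j : ℕ) := Nat.cast_nonneg _
              linarith
          have hC := MvPolynomial.totalDegree_eq_zero_iff_eq_C.1 hC
          have : {z : ℂ | planeEval z p = 0 ∧ planeEval z p0 = 0 ∧ planeEval z p1 = 0} = ∅ := by
            refine eq_empty_of_forall_notMem fun z hz => hp ?_
            have hz : planeEval z p = 0 := hz.1
            rw [hC, planeEval, MvPolynomial.eval_C] at hz
            rw [hC, hz, map_zero]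
          simp [this]
        · exact (measure_mono (inter_subset_inter_left _ fun z hz => hz.2.2)).trans_lt
            (ih p1 h1 (hdeg 1))
      · exact (measure_mono (inter_subset_inter_left _ fun z hz => hz.2.1)).trans_lt
          (ih p0 h0 (hdeg 0))
    have hre : μH[1] ({z : ℂ | planeEval z p = 0 ∧ planeEval z p1 ≠ 0 ∧
        |planeEval z p0| ≤ |planeEval z p1|} ∩ B) < ∞ := by
      -- `L = 3` because the imaginary parts differ by at most twice the difference of the real
      -- parts.
      refine hausdorffMeasure_le_of_fibers (π := Complex.re) (L := 3) (R := R) (d := p.totalDegree)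
        ?_ Complex.continuous_re (fun z hz => hz.2.1) (fun x => ?_) fun z hz => ?_
      · refine MeasurableSet.inter ?_ hB
        exact (measurableSet_eq_fun (hm p) measurable_const).inter
          ((measurableSet_eq_fun (hm p1) measurable_const).compl.inter
            (measurableSet_le (hm p0).norm (hm p1).norm))
      · obtain ⟨F, hF, h⟩ := fiber_card_le p 1 x
        exact ⟨F, hF, fun z hz hx => h z hz.1.1 hz.1.2.1 (by simpa using hx)⟩
      · obtain ⟨V, hV, h⟩ := exists_nhds_planeEval_lipschitz (p := p) (z := z)
          (c := |planeEval z p1| / 3) (by have := abs_pos.2 hz.1.2.1; positivity)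
        refine ⟨V, hV, fun a ha b hb => ?_⟩
        have := abs_le_two_mul_of_abs_le hz.1.2.2 hz.1.2.1 (h a ha.2 ha.1.1.1 b hb.2 hb.1.1.1)
        have h2 := Complex.norm_le_abs_re_add_abs_im (a - b)
        rw [dist_eq_norm]
        simp only [Complex.sub_re, Complex.sub_im] at h2
        push_cast
        linarith
    have him : μH[1] ({z : ℂ | planeEval z p = 0 ∧ planeEval z p0 ≠ 0 ∧
        |planeEval z p1| ≤ |planeEval z p0|} ∩ B) < ∞ := by
      refine hausdorffMeasure_le_of_fibers (π := Complex.im) (L := 3) (R := R) (d := p.totalDegree)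
        ?_ Complex.continuous_im (fun z hz => hz.2.2) (fun x => ?_) fun z hz => ?_
      · refine MeasurableSet.inter ?_ hB
        exact (measurableSet_eq_fun (hm p) measurable_const).inter
          ((measurableSet_eq_fun (hm p0) measurable_const).compl.inter
            (measurableSet_le (hm p1).norm (hm p0).norm))
      · obtain ⟨F, hF, h⟩ := fiber_card_le p 0 x
        exact ⟨F, hF, fun z hz hx => h z hz.1.1 hz.1.2.1 (by simpa using hx)⟩
      · obtain ⟨V, hV, h⟩ := exists_nhds_planeEval_lipschitz (p := p) (z := z)
          (c := |planeEval z p0| / 3) (by have := abs_pos.2 hz.1.2.1; positivity)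
        refine ⟨V, hV, fun a ha b hb => ?_⟩
        have h1 := h a ha.2 ha.1.1.1 b hb.2 hb.1.1.1
        rw [add_comm, add_comm |a.re - b.re|] at h1
        have := abs_le_two_mul_of_abs_le hz.1.2.2 hz.1.2.1 h1
        have h2 := Complex.norm_le_abs_re_add_abs_im (a - b)
        rw [dist_eq_norm]
        simp only [Complex.sub_re, Complex.sub_im] at h2
        push_cast
        linarith
    refine (measure_mono ?_).trans_lt ((measure_union_le _ _).trans_lt (ENNReal.add_lt_top.2
      ⟨hcrit, (measure_union_le _ _).trans_lt (ENNReal.add_lt_top.2 ⟨hre, him⟩)⟩))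
    rintro z ⟨hz, hzB⟩
    have hz : planeEval z p = 0 := hz
    by_cases hc : planeEval z p0 = 0 ∧ planeEval z p1 = 0
    · exact Or.inl ⟨⟨hz, hc⟩, hzB⟩
    · refine Or.inr ?_
      rcases le_total |planeEval z p0| |planeEval z p1| with h | h
      · refine Or.inl ⟨⟨hz, fun h1 => hc ⟨?_, h1⟩, h⟩, hzB⟩
        rw [h1, abs_zero] at h
        exact abs_nonpos_iff.1 h
      · refine Or.inr ⟨⟨hz, fun h1 => hc ⟨h1, ?_⟩, h⟩, hzB⟩
        rw [h1, abs_zero] at h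
        exact abs_nonpos_iff.1 h

/-! ### Norms on `ℂᵏ` and induced matrix norms -/

/-- A finite convex function on a finite-dimensional space is locally Lipschitz. -/
theorem seminorm_continuous {E : Type*} [NormedAddCommGroup E] [NormedSpace ℂ E]
    [FiniteDimensional ℂ E] (p : Seminorm ℂ E) : Continuous p := by
  have : FiniteDimensional ℝ E := FiniteDimensional.complexToReal E
  have h : ConvexOn ℝ univ (p.restrictScalars ℝ) := (p.restrictScalars ℝ).convexOn
  exact h.locallyLipschitz.continuous

/-- `p` need not be the ambient norm. Hahn–Banach gives a real functional `g ≤ p` with equality at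
the integral, and `g` commutes with the integral. -/
theorem seminorm_integral_le {E α : Type*} [NormedAddCommGroup E] [NormedSpace ℂ E]
    [FiniteDimensional ℂ E] [MeasurableSpace α] {μ : Measure α} (p : Seminorm ℂ E) {f : α → E}
    (hf : Integrable f μ) (hp : Integrable (fun a => p (f a)) μ) :
    p (∫ a, f a ∂μ) ≤ ∫ a, p (f a) ∂μ := by
  have : FiniteDimensional ℝ E := FiniteDimensional.complexToReal E
  have hreal (c : ℝ) (x : E) : p (c • x) = |c| * p x := by
    rw [← Complex.coe_smul, map_smul_eq_mul, Complex.norm_real, Real.norm_eq_abs]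
  set x := ∫ a, f a ∂μ with hx
  by_cases h0 : x = 0
  · rw [h0, map_zero]
    exact integral_nonneg fun a => apply_nonneg p _
  obtain ⟨g, hg, hgp⟩ := exists_extension_of_le_sublinear
    (LinearPMap.mkSpanSingleton x (p x) h0 : E →ₗ.[ℝ] ℝ) p
    (fun c hc y => by rw [hreal, abs_of_pos hc]) (map_add_le_add p) (by
      rintro ⟨y, hy⟩
      obtain ⟨c, rfl⟩ := Submodule.mem_span_singleton.1 hy
      have hc : (LinearPMap.mkSpanSingleton x (p x) h0 : E →ₗ.[ℝ] ℝ) ⟨c • x, hy⟩ = c • p x :=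
        LinearPMap.mkSpanSingleton'_apply x (p x) _ c hy
      rw [hc, hreal]
      exact mul_le_mul_of_nonneg_right (le_abs_self c) (apply_nonneg p x))
  have hgx : g x = p x := by
    have := hg ⟨x, Submodule.mem_span_singleton_self x⟩
    rw [LinearPMap.mkSpanSingleton_apply] at this
    exact this
  have hcomm := (LinearMap.toContinuousLinearMap g).integral_comp_comm hf
  simp only [LinearMap.coe_toContinuousLinearMap'] at hcomm
  rw [← hgx, hx, ← hcomm]
  exact integral_mono ((LinearMap.toContinuousLinearMap g).integrable_comp hf) hp fun a => hgp _

section InducedNorm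

variable {k : ℕ} {N : Seminorm ℂ (Fin k → ℂ)}

theorem exists_norm_le (hN : ∀ x : Fin k → ℂ, N x = 0 → x = 0) :
    ∃ m : ℝ, 0 < m ∧ ∀ x, ‖x‖ ≤ m * N x := by
  rcases (Metric.sphere (0 : Fin k → ℂ) 1).eq_empty_or_nonempty with h | h
  · refine ⟨1, one_pos, fun x => ?_⟩
    by_cases hx : x = 0
    · simp [hx]
    · have : ((‖x‖⁻¹ : ℝ) : ℂ) • x ∈ Metric.sphere (0 : Fin k → ℂ) 1 := by
        simp [norm_smul, hx]
      rw [h] at this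
      exact absurd this (notMem_empty _)
  · obtain ⟨y, hy, hmin⟩ := (isCompact_sphere (0 : Fin k → ℂ) 1).exists_isMinOn h
      (seminorm_continuous N).continuousOn
    have hy0 : 0 < N y := by
      refine lt_of_le_of_ne (apply_nonneg N y) fun h0 => ?_
      have := hN y h0.symm
      simp [this] at hy
    refine ⟨(N y)⁻¹, inv_pos.2 hy0, fun x => ?_⟩
    by_cases hx : x = 0
    · simp [hx]
    have hx' : 0 < ‖x‖ := norm_pos_iff.2 hx
    have : N y ≤ N (((‖x‖⁻¹ : ℝ) : ℂ) • x) := hmin (by simp [norm_smul, hx])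
    rw [map_smul_eq_mul, Complex.norm_real, norm_inv, norm_norm] at this
    rw [inv_mul_eq_div, le_div_iff₀ hy0]
    rwa [inv_mul_eq_div, le_div_iff₀ hx', mul_comm] at this

/-- This keeps `sInf` in `inducedNorm` away from its default value `0` on the empty set. -/
theorem inducedNorm_nonempty (hN : ∀ x : Fin k → ℂ, N x = 0 → x = 0)
    (B : Matrix (Fin k) (Fin k) ℂ) :
    {c : ℝ | 0 ≤ c ∧ ∀ x : Fin k → ℂ, N (B *ᵥ x) ≤ c * N x}.Nonempty := by
  obtain ⟨m, hm, hle⟩ := exists_norm_le hN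
  let q : Seminorm ℂ (Fin k → ℂ) := N.comp B.mulVecLin
  obtain ⟨C, hC, hq⟩ := Seminorm.bound_of_continuous_normedSpace q (seminorm_continuous q)
  refine ⟨C * m, by positivity, fun x => ?_⟩
  refine (hq x).trans ?_
  rw [mul_assoc]
  exact mul_le_mul_of_nonneg_left (hle x) hC.le

theorem inducedNorm_bddBelow (B : Matrix (Fin k) (Fin k) ℂ) :
    BddBelow {c : ℝ | 0 ≤ c ∧ ∀ x : Fin k → ℂ, N (B *ᵥ x) ≤ c * N x} :=
  ⟨0, fun _ h => h.1⟩

theorem inducedNorm_nonneg (B : Matrix (Fin k) (Fin k) ℂ) : 0 ≤ inducedNorm N B :=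
  Real.sInf_nonneg fun _ h => h.1

theorem inducedNorm_le {B : Matrix (Fin k) (Fin k) ℂ} {c : ℝ} (hc : 0 ≤ c)
    (h : ∀ x, N (B *ᵥ x) ≤ c * N x) : inducedNorm N B ≤ c :=
  csInf_le (inducedNorm_bddBelow B) ⟨hc, h⟩

theorem le_inducedNorm_mul (hN : ∀ x : Fin k → ℂ, N x = 0 → x = 0)
    (B : Matrix (Fin k) (Fin k) ℂ) (x : Fin k → ℂ) : N (B *ᵥ x) ≤ inducedNorm N B * N x := by
  by_cases hx : x = 0
  · simp [hx]
  have hx' : 0 < N x := lt_of_le_of_ne (apply_nonneg N x) fun h => hx (hN x h.symm)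
  rw [← div_le_iff₀ hx']
  refine le_csInf (inducedNorm_nonempty hN B) fun c hc => ?_
  rw [div_le_iff₀ hx']
  exact hc.2 x

theorem inducedNorm_smul_le (hN : ∀ x : Fin k → ℂ, N x = 0 → x = 0) (a : ℂ)
    (B : Matrix (Fin k) (Fin k) ℂ) : inducedNorm N (a • B) ≤ ‖a‖ * inducedNorm N B := by
  refine inducedNorm_le (mul_nonneg (norm_nonneg a) (inducedNorm_nonneg B)) fun x => ?_
  rw [Matrix.smul_mulVec, map_smul_eq_mul, mul_assoc]
  exact mul_le_mul_of_nonneg_left (le_inducedNorm_mul hN B x) (norm_nonneg a)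

theorem inducedNorm_zero : inducedNorm N (0 : Matrix (Fin k) (Fin k) ℂ) = 0 :=
  le_antisymm (inducedNorm_le le_rfl fun x => by simp) (inducedNorm_nonneg _)

theorem inducedNorm_smul (hN : ∀ x : Fin k → ℂ, N x = 0 → x = 0) (a : ℂ)
    (B : Matrix (Fin k) (Fin k) ℂ) : inducedNorm N (a • B) = ‖a‖ * inducedNorm N B := by
  refine le_antisymm (inducedNorm_smul_le hN a B) ?_
  by_cases ha : a = 0
  · simp [ha, inducedNorm_nonneg]
  have := inducedNorm_smul_le hN a⁻¹ (a • B)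
  rw [inv_smul_smul₀ ha, norm_inv] at this
  rwa [← le_inv_mul_iff₀ (norm_pos_iff.2 ha)]

theorem inducedNorm_add_le (hN : ∀ x : Fin k → ℂ, N x = 0 → x = 0)
    (B C : Matrix (Fin k) (Fin k) ℂ) :
    inducedNorm N (B + C) ≤ inducedNorm N B + inducedNorm N C := by
  refine inducedNorm_le (add_nonneg (inducedNorm_nonneg B) (inducedNorm_nonneg C)) fun x => ?_
  rw [Matrix.add_mulVec, add_mul]
  exact (map_add_le_add N _ _).trans
    (add_le_add (le_inducedNorm_mul hN B x) (le_inducedNorm_mul hN C x))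

theorem inducedNorm_eq_zero (hN : ∀ x : Fin k → ℂ, N x = 0 → x = 0)
    {B : Matrix (Fin k) (Fin k) ℂ} (h : inducedNorm N B = 0) : B = 0 := by
  refine Matrix.ext_of_mulVec_single fun i => ?_
  rw [Matrix.zero_mulVec]
  refine hN _ (le_antisymm ?_ (apply_nonneg N _))
  simpa [h] using le_inducedNorm_mul hN B (Pi.single i 1)

-- The induced norm is itself a seminorm on the finite-dimensional space of matrices.
attribute [local instance] Matrix.normedAddCommGroup Matrix.normedSpace in
theorem continuous_inducedNorm (hN : ∀ x : Fin k → ℂ, N x = 0 → x = 0) :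
    Continuous fun B : Matrix (Fin k) (Fin k) ℂ => inducedNorm N B :=
  seminorm_continuous (Seminorm.of (inducedNorm N) (inducedNorm_add_le hN) (inducedNorm_smul hN))

end InducedNorm

/-! ### The generalized resolvent as a rational matrix function -/

section Resolvent

variable {n k : ℕ} (A : Fin n → Matrix (Fin k) (Fin k) ℂ)

theorem genResolvent_apply [NeZero n] (j : Fin n) (z : ℂ) (a b : Fin k) :
    genResolvent A j z a b =
      (z • (1 : Matrix (Fin n × Fin k) (Fin n × Fin k) ℂ) - companion A)⁻¹ (0, a) (j, b) := by
  have h : ∀ (p q : Fin n × Fin k), (if p.1 = q.1 ∧ p.2 = q.2 then (1 : ℂ) else 0) =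
      if p = q then 1 else 0 := fun p q => by simp only [Prod.ext_iff]
  have h0 (j : Fin n) (p : Fin n × Fin k) (b : Fin k) :
      blockCol k j p b = if p = (j, b) then 1 else 0 := h p (j, b)
  simp [genResolvent, Matrix.mul_apply, h0]

theorem companion_mulVec_of_lt (x : Fin n × Fin k → ℂ) {i : Fin n} (hi : (i : ℕ) + 1 < n)
    (a : Fin k) : (companion A *ᵥ x) (i, a) = x (⟨i + 1, hi⟩, a) := by
  have h : ∀ p : Fin n × Fin k, companion A (i, a) p =
      if p = (⟨i + 1, hi⟩, a) then 1 else 0 := by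
    intro p
    simp only [companion, Matrix.of_apply, hi, if_true, Prod.ext_iff, Fin.ext_iff]
  simp [Matrix.mulVec, dotProduct, h]

theorem companion_mulVec_of_not_lt (x : Fin n × Fin k → ℂ) {i : Fin n} (hi : ¬ (i : ℕ) + 1 < n)
    (a : Fin k) : (companion A *ᵥ x) (i, a) = ∑ j, (A j *ᵥ fun b => x (j, b)) a := by
  simp only [Matrix.mulVec, dotProduct, companion, Matrix.of_apply, hi, if_false]
  rw [Fintype.sum_prod_type]

theorem isUnit_iff_charpoly (z : ℂ) :
    IsUnit (z • (1 : Matrix (Fin n × Fin k) (Fin n × Fin k) ℂ) - companion A) ↔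
      (companion A).charpoly.eval z ≠ 0 := by
  rw [Matrix.isUnit_iff_isUnit_det, isUnit_iff_ne_zero, Matrix.eval_charpoly,
    Matrix.smul_one_eq_diagonal]
  rfl

attribute [local instance] Matrix.linftyOpNormedRing Matrix.linftyOpNormedAlgebra in
theorem tendsto_resolvent_entry (p q : Fin n × Fin k) :
    Tendsto (fun z : ℂ => (z • (1 : Matrix (Fin n × Fin k) (Fin n × Fin k) ℂ) -
      companion A)⁻¹ p q) (Bornology.cobounded ℂ) (𝓝 0) := by
  have h := spectrum.resolvent_tendsto_cobounded (𝕜 := ℂ) (companion A)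
  have h2 : Tendsto (fun z => resolvent (companion A) z p q) (Bornology.cobounded ℂ) (𝓝 0) :=
    ((continuous_apply_apply p q).tendsto (0 : Matrix (Fin n × Fin k) (Fin n × Fin k) ℂ)).comp h
  refine h2.congr fun z => ?_
  rw [resolvent, Algebra.algebraMap_eq_smul_one, ← Matrix.nonsing_inv_eq_ringInverse]

/-- The numerator of the generalized resolvent over the characteristic polynomial. -/
def resolventNum [NeZero n] (j : Fin n) : Matrix (Fin k) (Fin k) (Polynomial ℂ) :=
  Matrix.of fun a b => (companion A).charmatrix.adjugate (0, a) (j, b)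

theorem charpoly_mul_resolvent_entry {z : ℂ} (hz : (companion A).charpoly.eval z ≠ 0)
    (p q : Fin n × Fin k) : (companion A).charpoly.eval z *
      (z • (1 : Matrix (Fin n × Fin k) (Fin n × Fin k) ℂ) - companion A)⁻¹ p q =
      ((companion A).charmatrix.adjugate p q).eval z := by
  have hmap : (companion A).charmatrix.map (Polynomial.evalRingHom z) =
      z • (1 : Matrix (Fin n × Fin k) (Fin n × Fin k) ℂ) - companion A := by
    ext p q
    by_cases h : p = q
    · subst h; simp [Matrix.charmatrix_apply_eq]
    · simp [h]
  have hadj : ((companion A).charmatrix.adjugate p q).eval z =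
      (z • (1 : Matrix (Fin n × Fin k) (Fin n × Fin k) ℂ) - companion A).adjugate p q := by
    rw [← hmap]
    have := (Polynomial.evalRingHom z).map_adjugate (companion A).charmatrix
    exact congrFun (congrFun this p) q
  have hdet : (z • (1 : Matrix (Fin n × Fin k) (Fin n × Fin k) ℂ) - companion A).det =
      (companion A).charpoly.eval z := by
    rw [Matrix.eval_charpoly, Matrix.smul_one_eq_diagonal]
    rfl
  rw [Matrix.inv_def, hdet, Matrix.smul_apply, Ring.inverse_eq_inv',
    smul_eq_mul, mul_inv_cancel_left₀ hz, hadj]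

theorem charpoly_smul_genResolvent [NeZero n] (j : Fin n) {z : ℂ}
    (hz : (companion A).charpoly.eval z ≠ 0) (a b : Fin k) :
    (companion A).charpoly.eval z * genResolvent A j z a b = (resolventNum A j a b).eval z := by
  rw [genResolvent_apply, charpoly_mul_resolvent_entry A hz]
  rfl

theorem differentiableAt_resolvent_mulVec (b : Fin n × Fin k → ℂ) {z : ℂ}
    (hz : (companion A).charpoly.eval z ≠ 0) :
    DifferentiableAt ℂ (fun z => (z • (1 : Matrix (Fin n × Fin k) (Fin n × Fin k) ℂ) -
      companion A)⁻¹ *ᵥ b) z := by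
  refine differentiableAt_pi.2 fun p => ?_
  have h1 : DifferentiableAt ℂ (fun z => ∑ q, ((companion A).charpoly.eval z)⁻¹ *
      ((companion A).charmatrix.adjugate p q).eval z * b q) z := by
    refine DifferentiableAt.fun_sum fun q _ => ?_
    exact (((companion A).charpoly.differentiable z).inv hz |>.mul
      (Polynomial.differentiable _ z)).mul_const _
  refine h1.congr_of_eventuallyEq ?_
  filter_upwards [(companion A).charpoly.continuous.continuousAt.eventually_ne hz] with w hw
  refine Finset.sum_congr rfl fun q _ => ?_
  rw [← charpoly_mul_resolvent_entry A hw, inv_mul_cancel_left₀ hw]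

/-- A representation of the generalized resolvent as a quotient of polynomials in lowest terms. -/
structure ReducedFraction [NeZero n] (j : Fin n) (q : Polynomial ℂ)
    (Q : Matrix (Fin k) (Fin k) (Polynomial ℂ)) : Prop where
  ne_zero : q ≠ 0
  cross : ∀ a b, q * resolventNum A j a b = (companion A).charpoly * Q a b
  num_ne_zero : ∀ z, q.eval z = 0 → Q.map (Polynomial.eval z) ≠ 0

/-- Take a denominator of least degree. A root of `q` at which all entries of `Q` vanish would allow
cancelling `X - z`. -/
theorem exists_reducedFraction [NeZero n] (j : Fin n) : ∃ q Q, ReducedFraction A j q Q := by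
  classical
  have hex : ∃ d : ℕ, ∃ (q : Polynomial ℂ) (Q : Matrix (Fin k) (Fin k) (Polynomial ℂ)),
      q.natDegree = d ∧ q ≠ 0 ∧
        ∀ a b, q * resolventNum A j a b = (companion A).charpoly * Q a b :=
    ⟨_, (companion A).charpoly, resolventNum A j, rfl, (companion A).charpoly_monic.ne_zero,
      fun _ _ => rfl⟩
  obtain ⟨q, Q, hd, hq, hc⟩ := Nat.find_spec hex
  refine ⟨q, Q, hq, hc, fun z hz hQ => ?_⟩
  obtain ⟨q', rfl⟩ := Polynomial.dvd_iff_isRoot.2 hz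
  have hX : (Polynomial.X - Polynomial.C z : Polynomial ℂ) ≠ 0 := Polynomial.X_sub_C_ne_zero z
  have hq' : q' ≠ 0 := right_ne_zero_of_mul hq
  have hdvd : ∀ a b, ∃ P, Q a b = (Polynomial.X - Polynomial.C z) * P := fun a b =>
    Polynomial.dvd_iff_isRoot.2 (congrFun (congrFun hQ a) b)
  choose Q' hQ' using hdvd
  refine Nat.find_min hex (m := q'.natDegree) ?_ ⟨q', Matrix.of Q', rfl, hq', fun a b => ?_⟩
  · rw [← hd, Polynomial.natDegree_mul hX hq', Polynomial.natDegree_X_sub_C]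
    omega
  · refine mul_left_cancel₀ hX ?_
    have := hc a b
    rw [hQ'] at this
    rw [Matrix.of_apply, ← mul_assoc, this]
    ring

variable {A} {j : Fin n} {q : Polynomial ℂ} {Q : Matrix (Fin k) (Fin k) (Polynomial ℂ)}

theorem continuous_map_eval (Q : Matrix (Fin k) (Fin k) (Polynomial ℂ)) :
    Continuous fun z => Q.map (Polynomial.eval z) :=
  continuous_matrix fun a b => (Q a b).continuous

theorem finite_roots_charpoly : {z : ℂ | (companion A).charpoly.eval z = 0}.Finite :=
  ((companion A).charpoly.roots.toFinset.finite_toSet).subset fun z hz => by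
    simpa [(companion A).charpoly_monic.ne_zero] using hz

theorem resolvent_identity {z : ℂ} (hz : (companion A).charpoly.eval z ≠ 0)
    (b : Fin n × Fin k → ℂ) :
    z • ((z • (1 : Matrix (Fin n × Fin k) (Fin n × Fin k) ℂ) - companion A)⁻¹ *ᵥ b) =
      b + companion A *ᵥ ((z • (1 : Matrix (Fin n × Fin k) (Fin n × Fin k) ℂ) -
        companion A)⁻¹ *ᵥ b) := by
  have hu := (Matrix.isUnit_iff_isUnit_det _).1 ((isUnit_iff_charpoly A z).2 hz)
  have h1 : (z • (1 : Matrix (Fin n × Fin k) (Fin n × Fin k) ℂ) - companion A) *ᵥ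
      ((z • (1 : Matrix (Fin n × Fin k) (Fin n × Fin k) ℂ) - companion A)⁻¹ *ᵥ b) = b := by
    rw [Matrix.mulVec_mulVec, Matrix.mul_nonsing_inv _ hu, Matrix.one_mulVec]
  rw [Matrix.sub_mulVec, Matrix.smul_mulVec, Matrix.one_mulVec, sub_eq_iff_eq_add] at h1
  exact h1

theorem eventually_charpoly_ne_zero (A : Fin n → Matrix (Fin k) (Fin k) ℂ) :
    ∀ᶠ z in Bornology.cobounded ℂ, (companion A).charpoly.eval z ≠ 0 :=
  Bornology.le_cofinite ℂ finite_roots_charpoly.eventually_cofinite_notMem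

variable [NeZero n]

theorem ReducedFraction.smul_eq (h : ReducedFraction A j q Q) {z : ℂ}
    (hz : (companion A).charpoly.eval z ≠ 0) :
    q.eval z • genResolvent A j z = Q.map (Polynomial.eval z) := by
  ext a b
  have h1 := congrArg (Polynomial.eval z) (h.cross a b)
  rw [Polynomial.eval_mul, Polynomial.eval_mul, ← charpoly_smul_genResolvent A j hz,
    mul_left_comm] at h1
  exact mul_left_cancel₀ hz h1

theorem ReducedFraction.eval_ne_zero (h : ReducedFraction A j q Q) {z : ℂ}
    (hz : (companion A).charpoly.eval z ≠ 0) : q.eval z ≠ 0 := fun h0 =>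
  h.num_ne_zero z h0 (by rw [← h.smul_eq hz, h0, zero_smul])

theorem ReducedFraction.genResolvent_eq (h : ReducedFraction A j q Q) {z : ℂ}
    (hz : (companion A).charpoly.eval z ≠ 0) :
    genResolvent A j z = (q.eval z)⁻¹ • Q.map (Polynomial.eval z) := by
  rw [← h.smul_eq hz, inv_smul_smul₀ (h.eval_ne_zero hz)]

variable {N : Seminorm ℂ (Fin k → ℂ)}

/-- The poles are exactly the roots of `q`: there `Q` does not vanish, so `‖Q‖ / |q|` blows up,
while elsewhere it has a finite limit, even at an eigenvalue. -/
theorem ReducedFraction.tendsto_atTop_iff (h : ReducedFraction A j q Q)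
    (hN : ∀ x : Fin k → ℂ, N x = 0 → x = 0) (z : ℂ) :
    Tendsto (fun w : ℂ => inducedNorm N (genResolvent A j w)) (𝓝[≠] z) atTop ↔ q.eval z = 0 := by
  have hχ : ∀ᶠ w in 𝓝[≠] z, (companion A).charpoly.eval w ≠ 0 :=
    nhdsNE_le_cofinite z finite_roots_charpoly.eventually_cofinite_notMem
  have heq : ∀ᶠ w in 𝓝[≠] z, ‖q.eval w‖⁻¹ * inducedNorm N (Q.map (Polynomial.eval w)) =
      inducedNorm N (genResolvent A j w) := by
    filter_upwards [hχ] with w hw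
    rw [h.genResolvent_eq hw, inducedNorm_smul hN, norm_inv]
  have hQc : Tendsto (fun w => inducedNorm N (Q.map (Polynomial.eval w))) (𝓝[≠] z)
      (𝓝 (inducedNorm N (Q.map (Polynomial.eval z)))) :=
    (((continuous_inducedNorm hN).comp (continuous_map_eval Q)).tendsto z).mono_left
      nhdsWithin_le_nhds
  have hqc : Tendsto (fun w => ‖q.eval w‖) (𝓝[≠] z) (𝓝 ‖q.eval z‖) :=
    (q.continuous.norm.tendsto z).mono_left nhdsWithin_le_nhds
  constructor
  · intro ht
    by_contra h0
    have := (hqc.inv₀ (norm_ne_zero_iff.2 h0)).mul hQc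
    exact not_tendsto_atTop_of_tendsto_nhds (this.congr' heq) ht
  · intro h0
    refine Tendsto.congr' heq ?_
    have hpos : 0 < inducedNorm N (Q.map (Polynomial.eval z)) :=
      lt_of_le_of_ne (inducedNorm_nonneg _) fun he =>
        h.num_ne_zero z h0 (inducedNorm_eq_zero hN he.symm)
    refine Tendsto.atTop_mul_pos hpos (tendsto_inv_nhdsGT_zero.comp ?_) hQc
    rw [h0, norm_zero] at hqc
    refine tendsto_nhdsWithin_iff.2 ⟨hqc, ?_⟩
    filter_upwards [hχ] with w hw
    exact norm_pos_iff.2 (h.eval_ne_zero hw)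

/-! ### Boundary, boundedness and nonemptiness of the pseudospectrum. -/

variable {ε : ℝ}

theorem ReducedFraction.mem_pseudospectrum (h : ReducedFraction A j q Q)
    (hN : ∀ x : Fin k → ℂ, N x = 0 → x = 0) (z : ℂ) :
    z ∈ pseudospectrum N A ε j ↔ ((companion A).charpoly.eval z ≠ 0 ∧
      ε⁻¹ < inducedNorm N (genResolvent A j z)) ∨ q.eval z = 0 := by
  rw [← h.tendsto_atTop_iff hN, ← isUnit_iff_charpoly]
  rfl

/-- The pseudospectrum with the removable singularities of the generalized resolvent filled in. -/
def filledPseudospectrum (N : Seminorm ℂ (Fin k → ℂ)) (q : Polynomial ℂ)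
    (Q : Matrix (Fin k) (Fin k) (Polynomial ℂ)) (ε : ℝ) : Set ℂ :=
  {z | ‖q.eval z‖ < ε * inducedNorm N (Q.map (Polynomial.eval z))}

theorem isOpen_filledPseudospectrum (hN : ∀ x : Fin k → ℂ, N x = 0 → x = 0) :
    IsOpen (filledPseudospectrum N q Q ε) :=
  isOpen_lt q.continuous.norm
    (continuous_const.mul ((continuous_inducedNorm hN).comp (continuous_map_eval Q)))

theorem ReducedFraction.mem_filled_of_root (h : ReducedFraction A j q Q)
    (hN : ∀ x : Fin k → ℂ, N x = 0 → x = 0) (hε : 0 < ε) {z : ℂ} (hz : q.eval z = 0) :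
    z ∈ filledPseudospectrum N q Q ε := by
  have hpos : 0 < inducedNorm N (Q.map (Polynomial.eval z)) :=
    lt_of_le_of_ne (inducedNorm_nonneg _) fun he =>
      h.num_ne_zero z hz (inducedNorm_eq_zero hN he.symm)
  change ‖q.eval z‖ < ε * _
  rw [hz, norm_zero]
  positivity

theorem ReducedFraction.mem_filled_iff (h : ReducedFraction A j q Q)
    (hN : ∀ x : Fin k → ℂ, N x = 0 → x = 0) (hε : 0 < ε) {z : ℂ}
    (hz : (companion A).charpoly.eval z ≠ 0) :
    z ∈ filledPseudospectrum N q Q ε ↔ z ∈ pseudospectrum N A ε j := by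
  rw [h.mem_pseudospectrum hN]
  have hq := h.eval_ne_zero hz
  simp only [hz, hq, ne_eq, not_false_eq_true, true_and, or_false]
  rw [h.genResolvent_eq hz, inducedNorm_smul hN, norm_inv, inv_mul_eq_div,
    lt_div_iff₀ (norm_pos_iff.2 hq), inv_mul_eq_div, div_lt_iff₀ hε, mul_comm]
  rfl

theorem ReducedFraction.pseudospectrum_subset (h : ReducedFraction A j q Q)
    (hN : ∀ x : Fin k → ℂ, N x = 0 → x = 0) (hε : 0 < ε) :
    pseudospectrum N A ε j ⊆ filledPseudospectrum N q Q ε := by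
  intro z hz
  rcases (h.mem_pseudospectrum hN z).1 hz with hz' | hz'
  · exact (h.mem_filled_iff hN hε hz'.1).2 hz
  · exact h.mem_filled_of_root hN hε hz'

/-- The sets differ only at eigenvalues, and removing finitely many points from an open set does not
change its closure. -/
theorem ReducedFraction.closure_eq (h : ReducedFraction A j q Q)
    (hN : ∀ x : Fin k → ℂ, N x = 0 → x = 0) (hε : 0 < ε) :
    closure (filledPseudospectrum N q Q ε) = closure (pseudospectrum N A ε j) := by
  refine subset_antisymm (closure_minimal ?_ isClosed_closure)
    (closure_mono (h.pseudospectrum_subset hN hε))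
  refine (((finite_roots_charpoly (A := A)).countable.dense_compl ℂ).open_subset_closure_inter
    (isOpen_filledPseudospectrum hN)).trans (closure_mono ?_)
  rintro z ⟨hz, hz'⟩
  exact (h.mem_filled_iff hN hε hz').1 hz

/-- The closures agree and filling only enlarges the interior. Hence a length bound for the filled
set suffices. -/
theorem ReducedFraction.frontier_filled_subset (h : ReducedFraction A j q Q)
    (hN : ∀ x : Fin k → ℂ, N x = 0 → x = 0) (hε : 0 < ε) :
    frontier (filledPseudospectrum N q Q ε) ⊆ frontier (pseudospectrum N A ε j) := by
  rw [(isOpen_filledPseudospectrum hN).frontier_eq, h.closure_eq hN hε]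
  exact fun z hz => ⟨hz.1, fun hi => hz.2 (h.pseudospectrum_subset hN hε (interior_subset hi))⟩

theorem ReducedFraction.frontier_subset (h : ReducedFraction A j q Q)
    (hN : ∀ x : Fin k → ℂ, N x = 0 → x = 0) (hε : 0 < ε) :
    frontier (pseudospectrum N A ε j) ⊆ frontier (filledPseudospectrum N q Q ε) ∪
      {z | (companion A).charpoly.eval z = 0} := by
  rw [(isOpen_filledPseudospectrum hN).frontier_eq, h.closure_eq hN hε]
  rintro z ⟨hz, hzi⟩
  by_contra hcon
  simp only [mem_union, not_or, Set.mem_sdiff, not_and, not_not, mem_ofPred_eq] at hcon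
  refine hzi (mem_interior.2 ⟨filledPseudospectrum N q Q ε ∩
    {z | (companion A).charpoly.eval z = 0}ᶜ, fun w hw => (h.mem_filled_iff hN hε hw.2).1 hw.1,
    (isOpen_filledPseudospectrum hN).inter (finite_roots_charpoly (A := A)).isClosed.isOpen_compl,
    hcon.1 hz, hcon.2⟩)

theorem tendsto_genResolvent (A : Fin n → Matrix (Fin k) (Fin k) ℂ) (j : Fin n) :
    Tendsto (genResolvent A j) (Bornology.cobounded ℂ) (𝓝 0) := by
  refine tendsto_pi_nhds.2 fun a => tendsto_pi_nhds.2 fun b => ?_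
  exact (tendsto_resolvent_entry A (0, a) (j, b)).congr fun z => (genResolvent_apply A j z a b).symm

theorem eventually_inducedNorm_genResolvent_lt (hN : ∀ x : Fin k → ℂ, N x = 0 → x = 0)
    (hε : 0 < ε) (A : Fin n → Matrix (Fin k) (Fin k) ℂ) (j : Fin n) :
    ∀ᶠ z in Bornology.cobounded ℂ, inducedNorm N (genResolvent A j z) < ε⁻¹ := by
  have h1 : Tendsto (fun z => inducedNorm N (genResolvent A j z)) (Bornology.cobounded ℂ) (𝓝 0) := by
    have := ((continuous_inducedNorm hN).tendsto 0).comp (tendsto_genResolvent A j)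
    rwa [inducedNorm_zero] at this
  exact h1.eventually (Iio_mem_nhds (inv_pos.2 hε))

theorem isBounded_pseudospectrum (hN : ∀ x : Fin k → ℂ, N x = 0 → x = 0) (hε : 0 < ε) :
    Bornology.IsBounded (pseudospectrum N A ε j) := by
  obtain ⟨q, Q, h⟩ := exists_reducedFraction A j
  have h2 : Bornology.IsBounded {z | inducedNorm N (genResolvent A j z) < ε⁻¹}ᶜ :=
    Bornology.isBounded_def.2 (by
      rw [compl_compl]; exact eventually_inducedNorm_genResolvent_lt hN hε A j)
  refine (h2.union (finite_roots_charpoly (A := A)).isBounded).subset fun z hz => ?_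
  rcases (h.mem_pseudospectrum hN z).1 hz with hz' | hz'
  · exact Or.inl fun hlt => lt_asymm hlt hz'.2
  · exact Or.inr (not_not.1 fun h' => h.eval_ne_zero h' hz')

/-- Suppose it vanished, and let `x` be column `(j, b)` of the resolvent, so `z x = e + M x`. The
shift rows of `M` propagate the vanishing of block `0` to blocks `1, …, j`. Row `(j, b)` then reads
`(M x) (j, b) = -1`, although `x → 0` at infinity. -/
theorem exists_genResolvent_ne_zero [NeZero k] (A : Fin n → Matrix (Fin k) (Fin k) ℂ) (j : Fin n) :
    ∃ z, (companion A).charpoly.eval z ≠ 0 ∧ genResolvent A j z ≠ 0 := by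
  by_contra! hcon
  set b : Fin k := 0
  set e : Fin n × Fin k → ℂ := Pi.single (j, b) 1
  set x : ℂ → Fin n × Fin k → ℂ := fun z =>
    (z • (1 : Matrix (Fin n × Fin k) (Fin n × Fin k) ℂ) - companion A)⁻¹ *ᵥ e
  have hx (z : ℂ) (p : Fin n × Fin k) : x z p =
      (z • (1 : Matrix (Fin n × Fin k) (Fin n × Fin k) ℂ) - companion A)⁻¹ p (j, b) := by
    simp [x, e]
  have hrow : ∀ i : ℕ, ∀ hi : i < n, i ≤ j → ∀ z, (companion A).charpoly.eval z ≠ 0 →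
      ∀ a, x z (⟨i, hi⟩, a) = 0 := by
    intro i
    induction i with
    | zero =>
      intro hi _ z hz a
      rw [hx]
      have := genResolvent_apply A j z a b
      rw [hcon z hz] at this
      exact this.symm
    | succ i ih =>
      intro hi hij z hz a
      have h1 := congrFun (resolvent_identity hz e) (⟨i, by omega⟩, a)
      rw [Pi.add_apply, companion_mulVec_of_lt A _ hi, Pi.smul_apply] at h1
      have h2 : e (⟨i, by omega⟩, a) = 0 := by
        refine Pi.single_eq_of_ne (fun h => ?_) _
        have := congrArg (fun p => (p.1 : ℕ)) h
        simp at this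
        omega
      have h3 := ih (by omega) (by omega) z hz a
      simp only [x] at h3 ⊢
      rw [h3, h2, smul_zero, zero_add] at h1
      exact h1.symm
  have hlim : Tendsto (fun z => (companion A *ᵥ x z) (j, b)) (Bornology.cobounded ℂ) (𝓝 0) := by
    have h1 : Tendsto x (Bornology.cobounded ℂ) (𝓝 0) := tendsto_pi_nhds.2 fun p => by
      simp only [hx]
      exact tendsto_resolvent_entry A p (j, b)
    have h2 : Continuous fun v : Fin n × Fin k → ℂ => (companion A *ᵥ v) (j, b) :=
      (continuous_apply _).comp (Continuous.matrix_mulVec continuous_const continuous_id)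
    simpa using! (h2.tendsto 0).comp h1
  have hconst : ∀ᶠ z in Bornology.cobounded ℂ, (companion A *ᵥ x z) (j, b) = -1 := by
    filter_upwards [eventually_charpoly_ne_zero A] with z hz
    have h1 := congrFun (resolvent_identity hz e) (j, b)
    have h2 := hrow j j.2 le_rfl z hz b
    have h3 : e (j, b) = 1 := Pi.single_eq_same _ _
    rw [Pi.add_apply, Pi.smul_apply, h3] at h1
    simp only [x, Fin.eta] at h2 ⊢
    rw [h2, smul_zero] at h1
    linear_combination -h1
  have := tendsto_nhds_unique (tendsto_const_nhds.congr' (hconst.mono fun _ h => h.symm)) hlim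
  norm_num at this

/-- Every root of `q` belongs to the set. Without roots `q` is constant, so the entries of `Q` are
polynomials tending to `0` at infinity, hence zero. -/
theorem pseudospectrum_nonempty [NeZero k] (hN : ∀ x : Fin k → ℂ, N x = 0 → x = 0) :
    (pseudospectrum N A ε j).Nonempty := by
  obtain ⟨q, Q, h⟩ := exists_reducedFraction A j
  suffices hroot : ∃ z, q.eval z = 0 by
    obtain ⟨z, hz⟩ := hroot
    exact ⟨z, (h.mem_pseudospectrum hN z).2 (Or.inr hz)⟩
  by_contra! hno
  have hdeg : q.degree = 0 := by
    by_contra hd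
    obtain ⟨z, hz⟩ := IsAlgClosed.exists_root q hd
    exact hno z hz
  have hqC := Polynomial.eq_C_of_degree_eq_zero hdeg
  have hQ0 : ∀ a b, Q a b = 0 := by
    intro a b
    have hlim : Tendsto (fun z => (Q a b).eval z) (Bornology.cobounded ℂ) (𝓝 0) := by
      have h1 : Tendsto (fun z => q.coeff 0 * genResolvent A j z a b) (Bornology.cobounded ℂ)
          (𝓝 (q.coeff 0 * 0)) :=
        (((continuous_apply_apply a b).tendsto _).comp (tendsto_genResolvent A j)).const_mul _
      rw [mul_zero] at h1
      refine h1.congr' ?_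
      filter_upwards [eventually_charpoly_ne_zero A] with z hz
      have := congrFun (congrFun (h.smul_eq hz) a) b
      rw [hqC, Polynomial.eval_C] at this
      exact this
    have hd : ¬ 0 < (Q a b).degree := fun hd =>
      not_tendsto_nhds_of_tendsto_atTop
        ((Q a b).tendsto_norm_atTop hd tendsto_norm_cobounded_atTop) _ hlim.norm
    have hC := Polynomial.eq_C_of_degree_le_zero (not_lt.1 hd)
    rw [hC] at hlim ⊢
    simp only [Polynomial.eval_C] at hlim
    rw [tendsto_nhds_unique tendsto_const_nhds hlim, map_zero]
  obtain ⟨z, hz, hne⟩ := exists_genResolvent_ne_zero A j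
  refine hne ?_
  rw [h.genResolvent_eq hz]
  ext a b
  simp [hQ0]

end Resolvent

/-! ### Boundary length for the Euclidean norm -/

/-- Complex-valued functions of `z` that are polynomials in `re z` and `im z`. -/
def IsPlanePoly (f : ℂ → ℂ) : Prop :=
  ∃ a b : MvPolynomial (Fin 2) ℝ, ∀ z, f z = planeEval z a + planeEval z b * Complex.I

theorem IsPlanePoly.const (c : ℂ) : IsPlanePoly fun _ => c :=
  ⟨MvPolynomial.C c.re, MvPolynomial.C c.im, fun z => by simp [planeEval]⟩

theorem IsPlanePoly.id : IsPlanePoly fun z => z :=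
  ⟨MvPolynomial.X 0, MvPolynomial.X 1, fun z => by simp [planeEval]⟩

theorem IsPlanePoly.add {f g : ℂ → ℂ} (hf : IsPlanePoly f) (hg : IsPlanePoly g) :
    IsPlanePoly fun z => f z + g z := by
  obtain ⟨a, b, h⟩ := hf
  obtain ⟨c, d, h'⟩ := hg
  refine ⟨a + c, b + d, fun z => ?_⟩
  simp only [h, h', map_add]
  push_cast
  ring

theorem IsPlanePoly.mul {f g : ℂ → ℂ} (hf : IsPlanePoly f) (hg : IsPlanePoly g) :
    IsPlanePoly fun z => f z * g z := by
  obtain ⟨a, b, h⟩ := hf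
  obtain ⟨c, d, h'⟩ := hg
  refine ⟨a * c - b * d, a * d + b * c, fun z => ?_⟩
  simp only [h, h', map_sub, map_add, map_mul]
  push_cast
  linear_combination (planeEval z b : ℂ) * planeEval z d * Complex.I_sq

theorem IsPlanePoly.star {f : ℂ → ℂ} (hf : IsPlanePoly f) :
    IsPlanePoly fun z => Star.star (f z) := by
  obtain ⟨a, b, h⟩ := hf
  refine ⟨a, -b, fun z => ?_⟩
  simp [h]

theorem IsPlanePoly.sub {f g : ℂ → ℂ} (hf : IsPlanePoly f) (hg : IsPlanePoly g) :
    IsPlanePoly fun z => f z - g z := by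
  simpa [sub_eq_add_neg] using hf.add ((IsPlanePoly.const (-1)).mul hg)

theorem IsPlanePoly.sum {ι : Type*} (s : Finset ι) {f : ι → ℂ → ℂ}
    (hf : ∀ i, IsPlanePoly (f i)) : IsPlanePoly fun z => ∑ i ∈ s, f i z := by
  classical
  induction s using Finset.induction_on with
  | empty => simpa using IsPlanePoly.const 0
  | insert i s hi ih =>
    simp only [Finset.sum_insert hi]
    exact (hf i).add ih

theorem IsPlanePoly.prod {ι : Type*} (s : Finset ι) {f : ι → ℂ → ℂ}
    (hf : ∀ i, IsPlanePoly (f i)) : IsPlanePoly fun z => ∏ i ∈ s, f i z := by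
  classical
  induction s using Finset.induction_on with
  | empty => simpa using IsPlanePoly.const 1
  | insert i s hi ih =>
    simp only [Finset.prod_insert hi]
    exact (hf i).mul ih

theorem IsPlanePoly.polynomial (p : Polynomial ℂ) : IsPlanePoly fun z => p.eval z := by
  induction p using Polynomial.induction_on' with
  | add p q hp hq => simpa using hp.add hq
  | monomial n a =>
    have := (IsPlanePoly.const a).mul (IsPlanePoly.prod (Finset.range n) fun _ => IsPlanePoly.id)
    simpa using this

theorem IsPlanePoly.det {ι : Type*} [Fintype ι] [DecidableEq ι] {M : ℂ → Matrix ι ι ℂ}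
    (hM : ∀ i j, IsPlanePoly fun z => M z i j) : IsPlanePoly fun z => (M z).det := by
  simp only [Matrix.det_apply']
  exact IsPlanePoly.sum _ fun σ => (IsPlanePoly.const _).mul (IsPlanePoly.prod _ fun i => hM _ _)

theorem hausdorffMeasure_planePoly_zeros_lt_top {f : ℂ → ℂ} (hf : IsPlanePoly f)
    (hne : ∃ z, f z ≠ 0) (R : ℝ) :
    μH[1] ({z : ℂ | f z = 0} ∩ (Icc (-R) R ×ℂ Icc (-R) R)) < ∞ := by
  obtain ⟨a, b, h⟩ := hf
  -- The real and imaginary parts vanish together exactly when the sum of their squares does.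
  have hiff : ∀ z, f z = 0 ↔ planeEval z (a ^ 2 + b ^ 2) = 0 := by
    intro z
    rw [map_add, map_pow, map_pow, h, Complex.ext_iff]
    simp only [Complex.add_re, Complex.ofReal_re, Complex.mul_re, Complex.I_re, mul_zero,
      Complex.ofReal_im, Complex.I_im, mul_one, sub_self, add_zero, Complex.zero_re,
      Complex.add_im, Complex.mul_im, zero_add, Complex.zero_im]
    constructor
    · rintro ⟨h1, h2⟩
      rw [h1, h2]; ring
    · intro h0
      constructor <;> nlinarith [sq_nonneg (planeEval z a), sq_nonneg (planeEval z b)]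
  have hP : a ^ 2 + b ^ 2 ≠ 0 := by
    rintro h0
    obtain ⟨z, hz⟩ := hne
    exact hz ((hiff z).2 (by rw [h0, map_zero]))
  simp only [hiff]
  exact hausdorffMeasure_zeroLocus_lt_top R _ _ hP le_rfl

section Euclidean

variable {k : ℕ} {N : Seminorm ℂ (Fin k → ℂ)}

/-- The quotient `N (B x) / N x` attains its maximum on a compact sphere and is invariant under
scaling. -/
theorem exists_inducedNorm_eq [NeZero k] (hN : ∀ x : Fin k → ℂ, N x = 0 → x = 0)
    (B : Matrix (Fin k) (Fin k) ℂ) : ∃ x, x ≠ 0 ∧ N (B *ᵥ x) = inducedNorm N B * N x := by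
  have hpos : ∀ x : Fin k → ℂ, x ≠ 0 → 0 < N x := fun x hx =>
    lt_of_le_of_ne (apply_nonneg N x) fun h => hx (hN x h.symm)
  have hne0 : ∀ x ∈ Metric.sphere (0 : Fin k → ℂ) 1, x ≠ 0 := by
    rintro x hx rfl
    simp at hx
  have hne : (Metric.sphere (0 : Fin k → ℂ) 1).Nonempty :=
    NormedSpace.sphere_nonempty.2 zero_le_one
  have hc := seminorm_continuous N
  obtain ⟨x, hx, hmax⟩ := (isCompact_sphere (0 : Fin k → ℂ) 1).exists_isMaxOn hne
    (f := fun x => N (B *ᵥ x) / N x) (ContinuousOn.div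
      (hc.comp (Continuous.matrix_mulVec continuous_const continuous_id)).continuousOn
      hc.continuousOn fun x hx => (hpos x (hne0 x hx)).ne')
  have hx0 := hne0 x hx
  refine ⟨x, hx0, le_antisymm (le_inducedNorm_mul hN B x) ?_⟩
  rw [← le_div_iff₀ (hpos x hx0)]
  refine inducedNorm_le (div_nonneg (apply_nonneg N _) (apply_nonneg N _)) fun y => ?_
  by_cases hy : y = 0
  · simp [hy]
  have hy' : 0 < ‖y‖ := norm_pos_iff.2 hy
  have h1 : N (B *ᵥ (((‖y‖⁻¹ : ℝ) : ℂ) • y)) / N (((‖y‖⁻¹ : ℝ) : ℂ) • y) ≤ N (B *ᵥ x) / N x :=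
    hmax (show ((‖y‖⁻¹ : ℝ) : ℂ) • y ∈ Metric.sphere (0 : Fin k → ℂ) 1 by simp [norm_smul, hy])
  rw [Matrix.mulVec_smul, map_smul_eq_mul, map_smul_eq_mul, mul_div_mul_left _ _ (by simp [hy]),
    div_le_iff₀ (hpos y hy)] at h1
  exact h1

/-- The Hermitian matrix `s² I - ε² Bᴴ B`. -/
def gramDefect (s : ℂ) (ε : ℝ) (B : Matrix (Fin k) (Fin k) ℂ) : Matrix (Fin k) (Fin k) ℂ :=
  (star s * s) • (1 : Matrix (Fin k) (Fin k) ℂ) - ((ε : ℂ) ^ 2) • (Bᴴ * B)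

theorem star_dotProduct_self (hE : ∀ x : Fin k → ℂ, N x = √(∑ i, ‖x i‖ ^ 2)) (x : Fin k → ℂ) :
    star x ⬝ᵥ x = ((N x ^ 2 : ℝ) : ℂ) := by
  rw [hE, Real.sq_sqrt (Finset.sum_nonneg fun i _ => sq_nonneg _)]
  simp [dotProduct, Complex.conj_mul']

theorem dotProduct_gramDefect (hE : ∀ x : Fin k → ℂ, N x = √(∑ i, ‖x i‖ ^ 2)) (s : ℂ) (ε : ℝ)
    (B : Matrix (Fin k) (Fin k) ℂ) (x : Fin k → ℂ) :
    star x ⬝ᵥ (gramDefect s ε B *ᵥ x) =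
      (((‖s‖ * N x) ^ 2 - (ε * N (B *ᵥ x)) ^ 2 : ℝ) : ℂ) := by
  have h1 : star x ⬝ᵥ ((Bᴴ * B) *ᵥ x) = ((N (B *ᵥ x) ^ 2 : ℝ) : ℂ) := by
    rw [← star_dotProduct_self hE, Matrix.star_mulVec, ← Matrix.mulVec_mulVec,
      Matrix.dotProduct_mulVec]
  rw [gramDefect, Matrix.sub_mulVec, dotProduct_sub, Matrix.smul_mulVec, Matrix.smul_mulVec,
    dotProduct_smul, dotProduct_smul, h1, Matrix.one_mulVec, star_dotProduct_self hE]
  simp only [smul_eq_mul, Complex.star_def, Complex.conj_mul']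
  push_cast
  ring

-- At equality the matrix is positive semidefinite, and its quadratic form vanishes at a vector
-- attaining the induced norm; such a vector lies in the kernel.
open scoped ComplexOrder in
theorem det_gramDefect_eq_zero [NeZero k] (hN : ∀ x : Fin k → ℂ, N x = 0 → x = 0)
    (hE : ∀ x : Fin k → ℂ, N x = √(∑ i, ‖x i‖ ^ 2)) {s : ℂ} {ε : ℝ} (hε : 0 < ε)
    {B : Matrix (Fin k) (Fin k) ℂ} (h : ‖s‖ = ε * inducedNorm N B) :
    (gramDefect s ε B).det = 0 := by
  have hpsd : (gramDefect s ε B).PosSemidef := by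
    refine Matrix.PosSemidef.of_dotProduct_mulVec_nonneg ?_ fun x => ?_
    · simp [Matrix.IsHermitian, gramDefect, mul_comm]
    · rw [dotProduct_gramDefect hE, Complex.zero_le_real, h, sub_nonneg, mul_assoc]
      have := le_inducedNorm_mul hN B x
      have := apply_nonneg N (B *ᵥ x)
      gcongr
  obtain ⟨x, hx, hxe⟩ := exists_inducedNorm_eq hN B
  refine Matrix.exists_mulVec_eq_zero_iff.1 ⟨x, hx, ?_⟩
  rw [← hpsd.dotProduct_mulVec_zero_iff, dotProduct_gramDefect hE, hxe, h]
  push_cast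
  ring

theorem det_gramDefect_ne_zero (hN : ∀ x : Fin k → ℂ, N x = 0 → x = 0)
    (hE : ∀ x : Fin k → ℂ, N x = √(∑ i, ‖x i‖ ^ 2)) {s : ℂ} {ε : ℝ} (hε : 0 < ε)
    {B : Matrix (Fin k) (Fin k) ℂ} (h : ε * inducedNorm N B < ‖s‖) :
    (gramDefect s ε B).det ≠ 0 := by
  intro h0
  obtain ⟨x, hx, hx0⟩ := Matrix.exists_mulVec_eq_zero_iff.2 h0
  have h1 := dotProduct_gramDefect hE s ε B x
  rw [hx0, dotProduct_zero, eq_comm, Complex.ofReal_eq_zero, sub_eq_zero] at h1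
  have hpos : 0 < N x := lt_of_le_of_ne (apply_nonneg N x) fun h => hx (hN x h.symm)
  have h2 : ε * N (B *ᵥ x) < ‖s‖ * N x :=
    calc ε * N (B *ᵥ x) ≤ ε * (inducedNorm N B * N x) := by
          gcongr; exact le_inducedNorm_mul hN B x
      _ = ε * inducedNorm N B * N x := by ring
      _ < ‖s‖ * N x := by gcongr
  have h3 : 0 ≤ ε * N (B *ᵥ x) := mul_nonneg hε.le (apply_nonneg N _)
  nlinarith

variable {n : ℕ} [NeZero n] {A : Fin n → Matrix (Fin k) (Fin k) ℂ}

theorem boundaryLength_lt_top [NeZero k] (hN : ∀ x : Fin k → ℂ, N x = 0 → x = 0)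
    (hE : ∀ x : Fin k → ℂ, N x = √(∑ i, ‖x i‖ ^ 2)) {ε : ℝ} (hε : 0 < ε) (j : Fin n) :
    boundaryLength N A ε j < ∞ := by
  obtain ⟨q, Q, h⟩ := exists_reducedFraction A j
  set D : ℂ → ℂ := fun z => (gramDefect (q.eval z) ε (Q.map (Polynomial.eval z))).det
  have hD : IsPlanePoly D := by
    refine IsPlanePoly.det fun a b => ?_
    simp only [gramDefect, Matrix.sub_apply, Matrix.smul_apply, smul_eq_mul, Matrix.mul_apply,
      Matrix.conjTranspose_apply, Matrix.map_apply]
    have hq := IsPlanePoly.polynomial q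
    exact ((hq.star.mul hq).mul (.const _)).sub ((IsPlanePoly.const _).mul
      (IsPlanePoly.sum _ fun c => (IsPlanePoly.polynomial (Q c a)).star.mul (.polynomial (Q c b))))
  -- Far from the origin the resolvent has norm below `ε⁻¹`, so the form is definite there and `D`
  -- is not identically zero.
  have hne : ∃ z, D z ≠ 0 := by
    obtain ⟨z, hz, hlt⟩ := ((eventually_charpoly_ne_zero A).and
      (eventually_inducedNorm_genResolvent_lt hN hε A j)).exists
    refine ⟨z, det_gramDefect_ne_zero hN hE hε ?_⟩
    have hq := norm_pos_iff.2 (h.eval_ne_zero hz)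
    rwa [h.genResolvent_eq hz, inducedNorm_smul hN, norm_inv, inv_mul_eq_div, div_lt_iff₀ hq,
      lt_inv_mul_iff₀ hε] at hlt
  obtain ⟨R, hR⟩ := (isBounded_pseudospectrum (A := A) (j := j) hN hε).subset_closedBall 0
  have hbox : frontier (pseudospectrum N A ε j) ⊆ Icc (-R) R ×ℂ Icc (-R) R := by
    intro z hz
    have hz' : z ∈ Metric.closedBall (0 : ℂ) R :=
      closure_minimal hR Metric.isClosed_closedBall hz.1
    rw [mem_closedBall_zero_iff] at hz'
    exact ⟨abs_le.1 ((Complex.abs_re_le_norm z).trans hz'),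
      abs_le.1 ((Complex.abs_im_le_norm z).trans hz')⟩
  have hsub : frontier (pseudospectrum N A ε j) ⊆
      ({z : ℂ | D z = 0} ∩ (Icc (-R) R ×ℂ Icc (-R) R)) ∪
        {z | (companion A).charpoly.eval z = 0} := by
    intro z hz
    rcases h.frontier_subset hN hε hz with hz' | hz'
    · refine Or.inl ⟨det_gramDefect_eq_zero hN hE hε (le_antisymm ?_ ?_), hbox hz⟩
      · have hle : filledPseudospectrum N q Q ε ⊆
            {z | ‖q.eval z‖ ≤ ε * inducedNorm N (Q.map (Polynomial.eval z))} := by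
          intro w hw
          have hw : ‖q.eval w‖ < ε * inducedNorm N (Q.map (Polynomial.eval w)) := hw
          exact hw.le
        exact closure_minimal hle (isClosed_le q.continuous.norm
            (continuous_const.mul ((continuous_inducedNorm hN).comp (continuous_map_eval Q)))) hz'.1
      · rw [(isOpen_filledPseudospectrum hN).frontier_eq] at hz'
        exact not_lt.1 hz'.2
    · exact Or.inr hz'
  -- Points are null for `μH[1]`, so the finitely many eigenvalues add no length.
  have : NullSingletonClass (μH[1] : Measure ℂ) := Measure.nullSingletonClass_hausdorff ℂ one_pos
  refine (measure_mono hsub).trans_lt ((measure_union_le _ _).trans_lt (ENNReal.add_lt_top.2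
    ⟨hausdorffMeasure_planePoly_zeros_lt_top hD hne R, ?_⟩))
  rw [(finite_roots_charpoly (A := A)).measure_zero]
  exact ENNReal.zero_lt_top

end Euclidean

/-! ### The transient bound -/

section Bound

variable {n k : ℕ} [NeZero n] {A : Fin n → Matrix (Fin k) (Fin k) ℂ}
  {j : Fin n} {q : Polynomial ℂ} {Q : Matrix (Fin k) (Fin k) (Polynomial ℂ)}
  {N : Seminorm ℂ (Fin k → ℂ)} {ε : ℝ}

/-- `e^{tz}` times the reduced form of the generalized resolvent, applied to a vector. -/
def expFraction (q : Polynomial ℂ) (Q : Matrix (Fin k) (Fin k) (Polynomial ℂ)) (w : Fin k → ℂ)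
    (t : ℝ) (z : ℂ) : Fin k → ℂ :=
  Complex.exp (t * z) • (q.eval z)⁻¹ • (Q.map (Polynomial.eval z) *ᵥ w)

theorem differentiableAt_expFraction (w : Fin k → ℂ) (t : ℝ) {z : ℂ} (hz : q.eval z ≠ 0) :
    DifferentiableAt ℂ (expFraction q Q w t) z := by
  have h0 : DifferentiableAt ℂ (fun z : ℂ => Complex.exp (t * z)) z := by fun_prop
  have h1 : DifferentiableAt ℂ
      (fun z : ℂ => (Q.map (Polynomial.eval z) *ᵥ w : Fin k → ℂ)) z := by
    refine differentiableAt_pi.2 fun a => ?_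
    have h2 : DifferentiableAt ℂ (fun z : ℂ => ∑ b, (Q a b).eval z * w b) z :=
      DifferentiableAt.fun_sum fun b _ => (Polynomial.differentiable _ z).mul_const _
    exact h2
  exact h0.smul (((q.differentiable z).inv hz).smul h1)

theorem re_le_pseudoAbscissa (hN : ∀ x : Fin k → ℂ, N x = 0 → x = 0) (hε : 0 < ε) {z : ℂ}
    (hz : z ∈ closure (pseudospectrum N A ε j)) : z.re ≤ pseudoAbscissa N A ε j := by
  have hbdd : BddAbove (Complex.re '' pseudospectrum N A ε j) := by
    obtain ⟨R, hR⟩ := (isBounded_pseudospectrum (A := A) (j := j) hN hε).subset_closedBall 0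
    refine ⟨R, ?_⟩
    rintro _ ⟨w, hw, rfl⟩
    have := hR hw
    rw [mem_closedBall_zero_iff] at this
    exact (Complex.re_le_norm w).trans this
  have hsub : pseudospectrum N A ε j ⊆ Complex.re ⁻¹' Iic (pseudoAbscissa N A ε j) :=
    fun w hw => le_csSup hbdd ⟨w, hw, rfl⟩
  exact closure_minimal hsub (isClosed_Iic.preimage Complex.continuous_re) hz

/-- A frontier point is outside the open set, whence `‖Q‖ / |q| ≤ ε⁻¹`, but in the closure of the
pseudospectrum, whence `z.re` is at most the abscissa. -/
theorem ReducedFraction.seminorm_expFraction_le (h : ReducedFraction A j q Q)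
    (hN : ∀ x : Fin k → ℂ, N x = 0 → x = 0) (hε : 0 < ε) (w : Fin k → ℂ) {t : ℝ} (ht : 0 ≤ t)
    {z : ℂ} (hz : z ∈ frontier (filledPseudospectrum N q Q ε)) :
    q.eval z ≠ 0 ∧ N (expFraction q Q w t z) ≤
      Real.exp (pseudoAbscissa N A ε j * t) / ε * N w := by
  rw [(isOpen_filledPseudospectrum hN).frontier_eq, h.closure_eq hN hε] at hz
  have hle : ε * inducedNorm N (Q.map (Polynomial.eval z)) ≤ ‖q.eval z‖ := not_lt.1 hz.2
  have hq : q.eval z ≠ 0 := fun h0 => hz.2 (h.mem_filled_of_root hN hε h0)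
  refine ⟨hq, ?_⟩
  have hq' := norm_pos_iff.2 hq
  rw [expFraction, map_smul_eq_mul, map_smul_eq_mul, Complex.norm_exp, norm_inv]
  have h1 : ‖q.eval z‖⁻¹ * N (Q.map (Polynomial.eval z) *ᵥ w) ≤ ε⁻¹ * N w := by
    have h2 := le_inducedNorm_mul hN (Q.map (Polynomial.eval z)) w
    have h3 : inducedNorm N (Q.map (Polynomial.eval z)) ≤ ε⁻¹ * ‖q.eval z‖ := by
      rwa [inv_mul_eq_div, le_div_iff₀ hε, mul_comm]
    rw [inv_mul_le_iff₀ hq']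
    calc _ ≤ _ := h2
      _ ≤ ε⁻¹ * ‖q.eval z‖ * N w := mul_le_mul_of_nonneg_right h3 (apply_nonneg N w)
      _ = _ := by ring
  have h4 : ((t : ℂ) * z).re ≤ pseudoAbscissa N A ε j * t := by
    have := mul_le_mul_of_nonneg_left (re_le_pseudoAbscissa hN hε hz.1) ht
    simpa [mul_comm] using this
  rw [div_mul_eq_mul_div, div_eq_mul_inv, mul_assoc, mul_comm (N w)]
  have := apply_nonneg N (Q.map (Polynomial.eval z) *ᵥ w)
  gcongr

/-- The integral does not depend on the cutoff, so `u` is exchanged for a mollified indicator `v` of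
the filled set. The gradient of `v` lives where the integrand is below `B + η` and has mass at most
the boundary length; then `η → 0`. -/
theorem ReducedFraction.seminorm_integral_expFraction_le (h : ReducedFraction A j q Q)
    (hN : ∀ x : Fin k → ℂ, N x = 0 → x = 0) (hε : 0 < ε) (w : Fin k → ℂ) {t : ℝ} (ht : 0 ≤ t)
    (hL : boundaryLength N A ε j ≠ ∞) {u : ℂ → ℝ} (hu : ContDiff ℝ 1 u)
    (hs : HasCompactSupport u) (hu1 : ∀ z, q.eval z = 0 → u =ᶠ[𝓝 z] fun _ => 1) :
    N (∫ z, gradForm u z • expFraction q Q w t z) ≤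
      Real.exp (pseudoAbscissa N A ε j * t) / ε * N w * (boundaryLength N A ε j).toReal := by
  set U := filledPseudospectrum N q Q ε
  set B := Real.exp (pseudoAbscissa N A ε j * t) / ε * N w
  have hB : 0 ≤ B := mul_nonneg (by positivity) (apply_nonneg N w)
  have hUo : IsOpen U := isOpen_filledPseudospectrum hN
  have hUb : Bornology.IsBounded U := by
    have := (isBounded_pseudospectrum (A := A) (j := j) hN hε).closure
    rw [← h.closure_eq hN hε] at this
    exact this.subset subset_closure
  have hLU : μH[1] (frontier U) ≤ boundaryLength N A ε j :=
    measure_mono (h.frontier_filled_subset hN hε)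
  have hLU' : μH[1] (frontier U) ≠ ∞ := ne_top_of_le_ne_top hL hLU
  have hdiff (v : ℂ → ℝ) (hv : ∀ z, q.eval z = 0 → v =ᶠ[𝓝 z] fun _ => 1) (z : ℂ) :
      DifferentiableAt ℂ (expFraction q Q w t) z ∨ v =ᶠ[𝓝 z] fun _ => 1 := by
    by_cases hz : q.eval z = 0
    · exact Or.inr (hv z hz)
    · exact Or.inl (differentiableAt_expFraction w t hz)
  have key : ∀ η : ℝ, 0 < η → N (∫ z, gradForm u z • expFraction q Q w t z) ≤
      (B + η) * (boundaryLength N A ε j).toReal := by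
    intro η hη
    set V : Set ℂ := {z | q.eval z ≠ 0} ∩ (fun z => N (expFraction q Q w t z)) ⁻¹' Iio (B + η)
    have hV : IsOpen V := by
      refine ContinuousOn.isOpen_inter_preimage ?_ (q.continuous.isOpen_preimage _ isOpen_ne)
        isOpen_Iio
      exact fun z hz => ((seminorm_continuous N).continuousAt.comp
        (differentiableAt_expFraction w t hz).continuousAt).continuousWithinAt
    have hKV : frontier U ⊆ V := fun z hz => by
      obtain ⟨h1, h2⟩ := h.seminorm_expFraction_le hN hε w ht hz
      exact ⟨h1, h2.trans_lt (lt_add_of_pos_right _ hη)⟩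
    have hKc : IsCompact (frontier U) :=
      hUb.isCompact_closure.of_isClosed_subset isClosed_frontier frontier_subset_closure
    -- `δ₁` confines the gradient of `v` to `V`; `δ₂` below makes `v = 1` near the roots of `q`.
    obtain ⟨δ₁, hδ₁, hth₁⟩ := hKc.exists_thickening_subset_open hV hKV
    have hfin : {z | q.eval z = 0}.Finite :=
      (q.roots.toFinset.finite_toSet).subset fun z hz => by simpa [h.ne_zero] using hz
    obtain ⟨δ₂, hδ₂, hth₂⟩ := hfin.isCompact.exists_thickening_subset_open hUo
      fun z hz => h.mem_filled_of_root hN hε hz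
    obtain ⟨v, hv, hvs, hv1, hv0, hvL⟩ := exists_smooth_indicator hUo.measurableSet hUb hLU'
      (lt_min hδ₁ hδ₂)
    have hv1' : ∀ z, q.eval z = 0 → v =ᶠ[𝓝 z] fun _ => 1 := fun z hz => hv1 z <|
      (Metric.ball_subset_ball (min_le_right _ _)).trans
        ((Metric.ball_subset_thickening (show z ∈ {z | q.eval z = 0} from hz) δ₂).trans hth₂)
    rw [integral_gradForm_congr hu hs hv hvs (hdiff u hu1) (hdiff v hv1')]
    have hci := continuous_gradForm_smul hv (hdiff v hv1')
    have hcs := hasCompactSupport_gradForm_smul hvs (expFraction q Q w t)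
    have hint := hci.integrable_of_hasCompactSupport (μ := volume) hcs
    have hNint : Integrable fun z => N (gradForm v z • expFraction q Q w t z) :=
      ((seminorm_continuous N).comp hci).integrable_of_hasCompactSupport
        (hcs.comp_left (map_zero N))
    have hgint : Integrable fun z => ‖gradForm v z‖ := by
      have h1 := continuous_gradForm_smul hv (F := fun _ => (1 : ℂ))
        fun z => Or.inl (differentiableAt_const _)
      have h2 := hasCompactSupport_gradForm_smul hvs (fun _ => (1 : ℂ))
      simp only [smul_eq_mul, mul_one] at h1 h2
      exact (h1.integrable_of_hasCompactSupport h2).norm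
    calc N (∫ z, gradForm v z • expFraction q Q w t z)
        ≤ ∫ z, N (gradForm v z • expFraction q Q w t z) := seminorm_integral_le N hint hNint
      _ ≤ ∫ z, (B + η) * ‖gradForm v z‖ := by
          refine integral_mono hNint (hgint.const_mul _) fun z => ?_
          simp only [map_smul_eq_mul]
          by_cases hz : Disjoint (Metric.ball z (min δ₁ δ₂)) (frontier U)
          · have : gradForm v z = 0 := by simp [gradForm, hv0 z hz]
            simp [this]
          · obtain ⟨x, hx, hxU⟩ := not_disjoint_iff.1 hz
            have hzV : z ∈ V := hth₁ (Metric.mem_thickening_iff.2 ⟨x, hxU, by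
              rw [dist_comm]; exact lt_of_lt_of_le hx (min_le_left _ _)⟩)
            rw [mul_comm]
            exact mul_le_mul_of_nonneg_right (le_of_lt hzV.2) (norm_nonneg _)
      _ = (B + η) * ∫ z, ‖gradForm v z‖ := integral_const_mul _ _
      _ ≤ (B + η) * (boundaryLength N A ε j).toReal := by
          gcongr
          rw [integral_eq_lintegral_of_nonneg_ae (Eventually.of_forall fun z => norm_nonneg _)
            hgint.aestronglyMeasurable]
          exact ENNReal.toReal_mono hL (hvL.trans hLU)
  have hlim : Tendsto (fun η : ℝ => (B + η) * (boundaryLength N A ε j).toReal) (𝓝[>] 0)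
      (𝓝 ((B + 0) * (boundaryLength N A ε j).toReal)) :=
    (Continuous.tendsto (by fun_prop) 0).mono_left nhdsWithin_le_nhds
  rw [add_zero] at hlim
  exact ge_of_tendsto hlim (eventually_nhdsWithin_of_forall key)

/-- At eigenvalues, where the matrix inverse has a default value, `gradForm u` vanishes. -/
theorem ReducedFraction.gradForm_smul_eq (h : ReducedFraction A j q Q) {u : ℂ → ℝ}
    (hu1 : ∀ z, (companion A).charpoly.eval z = 0 → u =ᶠ[𝓝 z] fun _ => 1) (w : Fin k → ℂ)
    (t : ℝ) (z : ℂ) :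
    gradForm u z • Complex.exp (t * z) • (genResolvent A j z *ᵥ w) =
      gradForm u z • expFraction q Q w t z := by
  by_cases hz : (companion A).charpoly.eval z = 0
  · rw [gradForm_eq_zero (hu1 z hz), zero_smul, zero_smul]
  · rw [expFraction, h.genResolvent_eq hz, Matrix.smul_mulVec]

theorem integrable_gradForm_smul_genResolvent (w : Fin k → ℂ) (t : ℝ) {u : ℂ → ℝ}
    (hu : ContDiff ℝ 1 u) (hs : HasCompactSupport u)
    (hu1 : ∀ z, (companion A).charpoly.eval z = 0 → u =ᶠ[𝓝 z] fun _ => 1) :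
    Integrable fun z => gradForm u z • Complex.exp (t * z) • (genResolvent A j z *ᵥ w) := by
  obtain ⟨q, Q, h⟩ := exists_reducedFraction A j
  simp_rw [h.gradForm_smul_eq hu1]
  refine (continuous_gradForm_smul hu fun z => ?_).integrable_of_hasCompactSupport
    (hasCompactSupport_gradForm_smul hs _)
  by_cases hz : (companion A).charpoly.eval z = 0
  · exact Or.inr (hu1 z hz)
  · exact Or.inl (differentiableAt_expFraction w t (h.eval_ne_zero hz))

theorem seminorm_integral_genResolvent_le (hN : ∀ x : Fin k → ℂ, N x = 0 → x = 0) (hε : 0 < ε)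
    (w : Fin k → ℂ) {t : ℝ} (ht : 0 ≤ t) {u : ℂ → ℝ} (hu : ContDiff ℝ 1 u)
    (hs : HasCompactSupport u)
    (hu1 : ∀ z, (companion A).charpoly.eval z = 0 → u =ᶠ[𝓝 z] fun _ => 1) :
    ENNReal.ofReal ((2 * Real.pi)⁻¹ *
      N (∫ z, gradForm u z • Complex.exp (t * z) • (genResolvent A j z *ᵥ w))) ≤
      boundaryLength N A ε j * ENNReal.ofReal (Real.exp (pseudoAbscissa N A ε j * t) /
        (2 * Real.pi * ε)) * ENNReal.ofReal (N w) := by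
  by_cases hw : w = 0
  · simp [hw]
  by_cases hL : boundaryLength N A ε j = ∞
  -- With infinite length and `w ≠ 0` the right side is `∞`; for `w = 0` both sides vanish, by `∞ *
  -- 0 = 0`.
  · have h1 : ENNReal.ofReal (N w) ≠ 0 := by
      rw [ne_eq, ENNReal.ofReal_eq_zero, not_le]
      exact lt_of_le_of_ne (apply_nonneg N w) fun h => hw (hN w h.symm)
    have h2 : ENNReal.ofReal (Real.exp (pseudoAbscissa N A ε j * t) / (2 * Real.pi * ε)) ≠ 0 := by
      rw [ne_eq, ENNReal.ofReal_eq_zero, not_le]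
      positivity
    rw [hL, ENNReal.top_mul h2, ENNReal.top_mul h1]
    exact le_top
  obtain ⟨q, Q, h⟩ := exists_reducedFraction A j
  simp_rw [h.gradForm_smul_eq hu1]
  have hb := h.seminorm_integral_expFraction_le hN hε w ht hL hu hs
    fun z hz => hu1 z (not_not.1 fun h' => h.eval_ne_zero h' hz)
  rw [← ENNReal.ofReal_toReal hL, ← ENNReal.ofReal_mul ENNReal.toReal_nonneg,
    ← ENNReal.ofReal_mul (by positivity)]
  refine ENNReal.ofReal_le_ofReal ((mul_le_mul_of_nonneg_left hb (by positivity)).trans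
    (le_of_eq ?_))
  field_simp

end Bound

/-! ### From the companion system to the bound for `y`. -/

section Solution

variable {n k : ℕ} {A : Fin n → Matrix (Fin k) (Fin k) ℂ} {y₀ : Fin n → Fin k → ℂ}
  {y : ℝ → Fin k → ℂ}

/-- The vector of the derivatives of orders `0, …, n - 1` of `y`. -/
def jet (n : ℕ) (y : ℝ → Fin k → ℂ) (t : ℝ) : Fin n × Fin k → ℂ :=
  fun p => iteratedDerivWithin p.1 y (Ici 0) t p.2

theorem IsSolution.hasDerivWithinAt_jet (hy : IsSolution A y₀ y) {t : ℝ} (ht : 0 ≤ t) :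
    HasDerivWithinAt (jet n y) (companion A *ᵥ jet n y t) (Ici 0) t := by
  refine hasDerivWithinAt_pi.2 fun p => ?_
  obtain ⟨i, a⟩ := p
  have h1 := (hy.differentiableOn i t ht).hasDerivWithinAt
  rw [← iteratedDerivWithin_succ] at h1
  refine (hasDerivWithinAt_pi.1 h1 a).congr_deriv ?_
  by_cases hi : (i : ℕ) + 1 < n
  · rw [companion_mulVec_of_lt A _ hi]
    rfl
  · have hin : (i : ℕ) + 1 = n := by omega
    rw [companion_mulVec_of_not_lt A _ hi, hin, hy.equation t ht, Finset.sum_apply]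
    rfl

variable [NeZero n]

theorem resolvent_mulVec_zero_block (b : Fin n × Fin k → ℂ) (z : ℂ) :
    (fun a => ((z • (1 : Matrix (Fin n × Fin k) (Fin n × Fin k) ℂ) - companion A)⁻¹ *ᵥ b) (0, a)) =
      ∑ j, genResolvent A j z *ᵥ fun a => b (j, a) := by
  ext a
  simp only [Matrix.mulVec, dotProduct, Finset.sum_apply, genResolvent_apply,
    Fintype.sum_prod_type]

/-- The first block of the contour formula for the jet. A single cutoff `u`, equal to `1` around all
eigenvalues, serves every `j`; it can afterwards be changed in each term separately. -/
theorem IsSolution.eq_sum_integral (hy : IsSolution A y₀ y) {t : ℝ} (ht : 0 ≤ t) {ρ : ℝ}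
    (hρ : ∀ z, ρ ≤ ‖z‖ → (companion A).charpoly.eval z ≠ 0) {u : ℂ → ℝ}
    (hu : ContDiff ℝ 1 u) (hs : HasCompactSupport u)
    (hu1 : ∀ z, ‖z‖ < ρ → u =ᶠ[𝓝 z] fun _ => 1) :
    -(2 * Real.pi * Complex.I) • y t =
      ∑ j, ∫ z, gradForm u z • Complex.exp (t * z) • (genResolvent A j z *ᵥ y₀ j) := by
  set r : ℂ → Fin n × Fin k → ℂ := fun z =>
    (z • (1 : Matrix (Fin n × Fin k) (Fin n × Fin k) ℂ) - companion A)⁻¹ *ᵥ jet n y 0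
  let T : (Fin n × Fin k → ℂ) →L[ℂ] (Fin n × Fin k → ℂ) :=
    LinearMap.toContinuousLinearMap (companion A).mulVecLin
  have hd : ∀ z, ρ ≤ ‖z‖ → DifferentiableAt ℂ r z := fun z hz =>
    differentiableAt_resolvent_mulVec A _ (hρ z hz)
  have hlim : Tendsto r (Bornology.cobounded ℂ) (𝓝 0) := by
    refine tendsto_pi_nhds.2 fun p => ?_
    have : Tendsto (fun z => ∑ q, (z • (1 : Matrix (Fin n × Fin k) (Fin n × Fin k) ℂ) -
        companion A)⁻¹ p q * jet n y 0 q) (Bornology.cobounded ℂ)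
        (𝓝 (∑ q, 0 * jet n y 0 q)) :=
      tendsto_finsetSum _ fun q _ => (tendsto_resolvent_entry A p q).mul_const _
    simpa using! this
  have hmain := solution_eq_integral_resolvent (T := T) (b := jet n y 0) (r := r) (Y := jet n y)
    hu hs hu1 hd (fun z hz => resolvent_identity (hρ z hz) _) hlim rfl
    (fun s hs => hy.hasDerivWithinAt_jet hs) ht
  let P : (Fin n × Fin k → ℂ) →L[ℂ] (Fin k → ℂ) :=
    ContinuousLinearMap.pi fun a => ContinuousLinearMap.proj (0, a)
  have hint : Integrable fun z => gradForm u z • Complex.exp (t * z) • r z := by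
    refine (continuous_gradForm_smul hu fun z => ?_).integrable_of_hasCompactSupport
      (hasCompactSupport_gradForm_smul hs _)
    rcases le_or_gt ρ ‖z‖ with hz | hz
    · have h0 : DifferentiableAt ℂ (fun z : ℂ => Complex.exp (t * z)) z := by fun_prop
      exact Or.inl (h0.smul (hd z hz))
    · exact Or.inr (hu1 z hz)
  have hu1' : ∀ z, (companion A).charpoly.eval z = 0 → u =ᶠ[𝓝 z] fun _ => 1 := fun z hz =>
    hu1 z (not_le.1 fun h => hρ z h hz)
  have h0 : P (jet n y t) = y t := by
    ext a
    change iteratedDerivWithin ((0 : Fin n) : ℕ) y (Ici 0) t a = y t a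
    simp
  have hP := congrArg P hmain
  rw [map_smul, h0, ← P.integral_comp_comm hint] at hP
  rw [hP, ← integral_finsetSum _ fun j _ =>
    integrable_gradForm_smul_genResolvent (y₀ j) t hu hs hu1']
  refine integral_congr_ae (Eventually.of_forall fun z => ?_)
  have h2 : P (r z) = ∑ j, genResolvent A j z *ᵥ y₀ j := by
    refine (resolvent_mulVec_zero_block (A := A) (jet n y 0) z).trans ?_
    refine Finset.sum_congr rfl fun j _ => ?_
    rw [← hy.initial j]
    rfl
  simp only [map_smul, h2, Finset.smul_sum]

theorem exists_bump (ρ : ℝ) : ∃ u : ℂ → ℝ, ContDiff ℝ 1 u ∧ HasCompactSupport u ∧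
    ∀ z, ‖z‖ < ρ → u =ᶠ[𝓝 z] fun _ => 1 := by
  -- The maximum with `1` keeps the inner radius positive whatever `ρ` is.
  let φ : ContDiffBump (0 : ℂ) := ⟨max ρ 1, max ρ 1 + 1, by positivity, by linarith⟩
  refine ⟨φ, φ.contDiff, φ.hasCompactSupport, fun z hz => ?_⟩
  refine φ.eventuallyEq_one_of_mem_ball ?_
  rw [mem_ball_zero_iff]
  exact lt_of_lt_of_le hz (le_max_left _ _)

theorem IsSolution.seminorm_le {N : Seminorm ℂ (Fin k → ℂ)}
    (hN : ∀ x : Fin k → ℂ, N x = 0 → x = 0) (hy : IsSolution A y₀ y) {ε : ℝ} (hε : 0 < ε) {t : ℝ}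
    (ht : 0 ≤ t) :
    ENNReal.ofReal (N (y t)) ≤
      ∑ j : Fin n, boundaryLength N A ε j *
        ENNReal.ofReal (Real.exp (pseudoAbscissa N A ε j * t) / (2 * Real.pi * ε)) *
          ENNReal.ofReal (N (y₀ j)) := by
  obtain ⟨R, hR⟩ := (finite_roots_charpoly (A := A)).isBounded.subset_ball 0
  have hρ : ∀ z, R ≤ ‖z‖ → (companion A).charpoly.eval z ≠ 0 := fun z hz h0 =>
    absurd (mem_ball_zero_iff.1 (hR h0)) (not_lt.2 hz)
  obtain ⟨u, hu, hs, hu1⟩ := exists_bump R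
  have hu1' : ∀ z, (companion A).charpoly.eval z = 0 → u =ᶠ[𝓝 z] fun _ => 1 := fun z hz =>
    hu1 z (not_le.1 fun h => hρ z h hz)
  set I := fun j => ∫ z, gradForm u z • Complex.exp (t * z) • (genResolvent A j z *ᵥ y₀ j)
  have hsum : N (y t) ≤ ∑ j, (2 * Real.pi)⁻¹ * N (I j) := by
    have h1 := congrArg N (hy.eq_sum_integral ht hρ hu hs hu1)
    have h2 : ‖-(2 * (Real.pi : ℂ) * Complex.I)‖ = 2 * Real.pi := by
      simp [abs_of_pos Real.pi_pos]
    rw [map_smul_eq_mul, h2] at h1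
    rw [← Finset.mul_sum, le_inv_mul_iff₀ (by positivity), h1]
    exact Finset.le_sum_of_subadditive N (map_zero N).le (map_add_le_add N) Finset.univ I
  refine (ENNReal.ofReal_le_ofReal hsum).trans ?_
  rw [ENNReal.ofReal_sum_of_nonneg fun j _ => mul_nonneg (by positivity) (apply_nonneg N _)]
  exact Finset.sum_le_sum fun j _ => seminorm_integral_genResolvent_le hN hε (y₀ j) ht hu hs hu1'

end Solution

end HigherOrderODE

end

theorem mainTheorem3 {n k : ℕ} [NeZero n] [NeZero k]
    (N : Seminorm ℂ (Fin k → ℂ)) (hN : ∀ x : Fin k → ℂ, N x = 0 → x = 0)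
    (A : Fin n → Matrix (Fin k) (Fin k) ℂ) (y₀ : Fin n → Fin k → ℂ) (y : ℝ → Fin k → ℂ)
    (hy : HigherOrderODE.IsSolution A y₀ y) (ε : ℝ) (hε : 0 < ε) :
    (∀ j : Fin n, (HigherOrderODE.pseudospectrum N A ε j).Nonempty ∧
      Bornology.IsBounded (HigherOrderODE.pseudospectrum N A ε j)) ∧
    ((∀ x : Fin k → ℂ, N x = √(∑ i, ‖x i‖ ^ 2)) →
      ∀ j : Fin n, HigherOrderODE.boundaryLength N A ε j < ∞) ∧
    ∀ t : ℝ, 0 ≤ t →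
      ENNReal.ofReal (N (y t)) ≤
        ∑ j : Fin n, HigherOrderODE.boundaryLength N A ε j *
          ENNReal.ofReal (Real.exp (HigherOrderODE.pseudoAbscissa N A ε j * t) /
            (2 * Real.pi * ε)) *
          ENNReal.ofReal (N (y₀ j)) := by
  exact ⟨fun j => ⟨HigherOrderODE.pseudospectrum_nonempty hN,
      HigherOrderODE.isBounded_pseudospectrum hN hε⟩,
    fun hE j => HigherOrderODE.boundaryLength_lt_top hN hE hε j,
    fun t ht => hy.seminorm_le hN hε ht⟩
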